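/- **Corollary 2.3.** Let $T$ be an infinite, locally finite tree rooted at $o$. Write $|v|$ for the distance of $v$ from $o$, $v\to w$ if $v$ is the parent of $w$, and $T_n=\{v:|v|=n\}$. Assume that $T$ is spherically symmetric: every vertex $v$ has exactly $d_{|v|}$ children (so $T$ has no leaves, except possibly $o$). Given an inverse temperature $\beta>0$ and interaction strengths $J(e)$ on the edges $e$ of $T$, a *Gibbs state* is a probability measure on $\{+1,-1\}^{V(T)}$ (with the product $\sigma$-algebra) that satisfies the DLR equations: for every finite set $\Lambda\subset V(T)$, conditionally on the spins off $\Lambda$, the configuration $\eta$ in $\Lambda$ has probability proportional to $\prod \exp(\beta J(vw)\eta(v)\eta(w))$, the product being over the edges $vw$ with at least one end in $\Lambda$. (a) Suppose that $0<J_{\min}\le J(e)\le J_{\max}<\infty$ for all edges $e$, and that the biases depend only on the level: $\tanh(\beta J(vw))=\theta_{|w|}$ whenever $v\to w$. Then there are multiple Gibbs states if and only if $$\sum_{n\ge 1}\prod_{i=1}^n (d_i\theta_i)^{-2}<\infty .$$ (b) Suppose that the interaction strength is a constant $J>0$, and that $|T_n|\asymp\theta^{-n}n^{\alpha}$ as $n\to\infty$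 for some $\theta\in(0,1)$ and $\alpha\in\mathbb R$. Call $\beta>0$ critical if there is a unique Gibbs state at every inverse temperature in $(0,\beta)$ and there are multiple Gibbs states at every inverse temperature greater than $\beta$. Then $\beta$ is critical if and only if $\tanh(\beta J)=\theta$, and at the critical $\beta$ there is a unique Gibbs state if and only if $\alpha\le 1/2$. -/

import Mathlib

open Filter Asymptotics

section IsingModel

/-- In the graph `G` rooted at `o`, the vertex `v` is the parent of `w`:
they are adjacent and `w` is one step further from the root. -/
def IsParent {V : Type*} (G : SimpleGraph V) (o v w : V) : Prop :=
  G.Adj v w ∧ G.dist o w = G.dist o v + 1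

/-- The set of children of `v` in the graph `G` rooted at `o`. -/
def children {V : Type*} (G : SimpleGraph V) (o v : V) : Set V :=
  {w | IsParent G o v w}

/-- The set of vertices at distance `n` from the root `o`. -/
def level {V : Type*} (G : SimpleGraph V) (o : V) (n : ℕ) : Set V :=
  {v | G.dist o v = n}

/-- The spin value `+1` or `-1`, where `true` stands for plus and `false` for minus. -/
def spin (b : Bool) : ℝ := if b then 1 else -1

/-- The product `η(v) η(w)` of the spins at the two ends of the edge `e = vw`. -/
def edgeSpin {V : Type*} (η : V → Bool) (e : Sym2 V) : ℝ :=
  Sym2.mul (e.map fun v => spin (η v))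

open scoped Classical in
/-- The finite set of edges of `G` that have at least one end in the finite set `Λ`. -/
noncomputable def edgesMeeting {V : Type*} (G : SimpleGraph V) [G.LocallyFinite]
    (Λ : Finset V) : Finset (Sym2 V) :=
  Λ.biUnion fun v => G.incidenceFinset v

/-- The weight `∏ exp (β J(vw) η(v) η(w))` over the edges `vw` meeting `Λ`. -/
noncomputable def isingWeight {V : Type*} (G : SimpleGraph V) [G.LocallyFinite]
    (β : ℝ) (J : Sym2 V → ℝ) (Λ : Finset V) (η : V → Bool) : ℝ :=
  ∏ e ∈ edgesMeeting G Λ, Real.exp (β * J e * edgeSpin η e)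

open scoped Classical in
/-- The configuration equal to `σ` on `Λ` and to `ω` off `Λ`. -/
noncomputable def glue {V : Type*} (Λ : Finset V) (σ : Λ → Bool) (ω : V → Bool) : V → Bool :=
  fun v => if h : v ∈ Λ then σ ⟨v, h⟩ else ω v

open scoped Classical in
/-- The partition function in `Λ` with boundary condition `ω`. -/
noncomputable def partitionFunction {V : Type*} (G : SimpleGraph V) [G.LocallyFinite]
    (β : ℝ) (J : Sym2 V → ℝ) (Λ : Finset V) (ω : V → Bool) : ℝ :=
  ∑ σ : Λ → Bool, isingWeight G β J Λ (glue Λ σ ω)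

open scoped Classical in
/-- The finite-volume Ising measure in `Λ` with boundary condition `ω` off `Λ` and
no external field: each configuration that agrees with `ω` off `Λ` has probability
proportional to its weight. -/
noncomputable def finiteVolumeIsing {V : Type*} (G : SimpleGraph V) [G.LocallyFinite]
    (β : ℝ) (J : Sym2 V → ℝ) (Λ : Finset V) (ω : V → Bool) :
    MeasureTheory.Measure (V → Bool) :=
  ∑ σ : Λ → Bool,
    ENNReal.ofReal (isingWeight G β J Λ (glue Λ σ ω) / partitionFunction G β J Λ ω) •
      MeasureTheory.Measure.dirac (glue Λ σ ω)

/-- Gibbs states of the Ising model on `G` (with free choice of the behaviour at infinity):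
probability measures on configurations, with the product sigma-algebra, that satisfy the
Dobrushin-Lanford-Ruelle equations for all finite sets of vertices. -/
structure IsGibbsState {V : Type*} (G : SimpleGraph V) [G.LocallyFinite]
    (β : ℝ) (J : Sym2 V → ℝ) (μ : MeasureTheory.Measure (V → Bool)) : Prop where
  isProbabilityMeasure : MeasureTheory.IsProbabilityMeasure μ
  dlr : ∀ (Λ : Finset V) (A : Set (V → Bool)), MeasurableSet A →
    μ A = ∫⁻ ω, finiteVolumeIsing G β J Λ ω A ∂μ

/-- There are at least two Gibbs states. -/
def MultipleGibbsStates {V : Type*} (G : SimpleGraph V) [G.LocallyFinite]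
    (β : ℝ) (J : Sym2 V → ℝ) : Prop :=
  ∃ μ ν, IsGibbsState G β J μ ∧ IsGibbsState G β J ν ∧ μ ≠ ν

/-- There is exactly one Gibbs state. -/
def UniqueGibbsState {V : Type*} (G : SimpleGraph V) [G.LocallyFinite]
    (β : ℝ) (J : Sym2 V → ℝ) : Prop :=
  ∃! μ, IsGibbsState G β J μ

/-- The inverse temperature `β > 0` is critical for the interaction `J`: the Gibbs state is
unique at all smaller positive inverse temperatures, and not unique at all larger ones. -/
def IsCritical {V : Type*} (G : SimpleGraph V) [G.LocallyFinite]
    (β : ℝ) (J : Sym2 V → ℝ) : Prop :=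
  0 < β ∧ (∀ β', 0 < β' → β' < β → UniqueGibbsState G β' J) ∧
    ∀ β', β < β' → MultipleGibbsStates G β' J

end IsingModel

/-! On a tree the spins can be summed out from the boundary inwards. With a boundary condition fixed
off the ball of radius N, summing out level n + 1 leaves a field on level n: a child with field h
hands its parent `passUp c h`, where tanh (passUp c h) = tanh c * tanh h. By spherical symmetry the
plus boundary gives a constant field b_n on level n, with b_N = d_N c_{N+1} and b_n = d_n * passUp
c_{n+1} b_{n+1}. The minus boundary gives -b_n, and every other one a field bounded by b_n. The
question is whether b_n tends to 0 as N grows.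

The recursion is nearly additive for inverse squares: with θ = tanh c, (passUp c h)⁻² lies between
θ⁻²(h⁻² + (1 - θ²)/2) and θ⁻²(h⁻² + 1) (`le_inv_passUp_sq`, `inv_passUp_sq_le`). Put A_n = ∏_{i<n}
(d_i θ_{i+1})⁻² (`inverseSquareGrowth`). Then A_n b_n⁻² is squeezed between κ ∑_{n<k≤N} A_k and
∑_{n<k≤N+1} A_k (`exists_hasBoundaryField`). If ∑ A_k converges, the root field stays away from 0
and the plus and minus limits differ at the root. If it diverges, the field on each fixed level
vanishes and no finite marginal feels the boundary (`multiple_and_unique_of_summable`).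

In (a) the stated series differs from ∑ A_k by bounded factors and a shift of index. In (b) |T_n| is
the product of the d_i, so A_n is comparable to (θ / tanh (βJ))^{2n} n^{-2α}, which is summable when
tanh (βJ) > θ, or at equality when α > 1/2. -/

open MeasureTheory
open scoped Topology ENNReal NNReal

/-! ### Finite sums over spin configurations -/

section SpinSums

variable {V : Type*}

open scoped Classical in
/-- The sum of `F` over all configurations that agree with `ω` off `Λ`. -/
noncomputable def spinSum (Λ : Finset V) (F : (V → Bool) → ℝ) (ω : V → Bool) : ℝ :=
  ∑ σ : Λ → Bool, F (glue Λ σ ω)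

open scoped Classical in
lemma glue_eq_updateFinset (Λ : Finset V) (σ : Λ → Bool) (ω : V → Bool) :
    glue Λ σ ω = Function.updateFinset ω Λ σ := rfl

lemma glue_apply_mem {Λ : Finset V} (σ : Λ → Bool) (ω : V → Bool) {v : V} (h : v ∈ Λ) :
    glue Λ σ ω v = σ ⟨v, h⟩ := by simp [glue, h]

lemma glue_apply_notMem {Λ : Finset V} (σ : Λ → Bool) (ω : V → Bool) {v : V} (h : v ∉ Λ) :
    glue Λ σ ω v = ω v := by simp [glue, h]

lemma DependsOn.glue_eq {α : Type*} {F : (V → Bool) → α} {Λ : Finset V}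
    (hF : DependsOn F (Λ : Set V)ᶜ) (σ : Λ → Bool) (ω : V → Bool) : F (glue Λ σ ω) = F ω :=
  hF fun _ hv => glue_apply_notMem σ ω (by simpa using hv)

open scoped Classical in
lemma spinSum_union {s t : Finset V} (h : Disjoint s t) (F : (V → Bool) → ℝ) (ω : V → Bool) :
    spinSum (s ∪ t) F ω = spinSum s (spinSum t F) ω := by
  unfold spinSum
  rw [← Fintype.sum_prod_type']
  symm
  refine Fintype.sum_equiv (Equiv.piFinsetUnion (fun _ => Bool) h) _ _ fun x => ?_
  rw [glue_eq_updateFinset, glue_eq_updateFinset, glue_eq_updateFinset,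
    Function.updateFinset_updateFinset h]

open scoped Classical in
lemma spinSum_sdiff {Λ M : Finset V} (h : Λ ⊆ M) (F : (V → Bool) → ℝ) (ω : V → Bool) :
    spinSum M F ω = spinSum (M \ Λ) (spinSum Λ F) ω := by
  rw [← spinSum_union Finset.sdiff_disjoint, Finset.sdiff_union_of_subset h]

open scoped Classical in
lemma spinSum_sdiff' {Λ M : Finset V} (h : Λ ⊆ M) (F : (V → Bool) → ℝ) (ω : V → Bool) :
    spinSum M F ω = spinSum Λ (spinSum (M \ Λ) F) ω := by
  rw [← spinSum_union Finset.disjoint_sdiff, Finset.union_sdiff_of_subset h]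

lemma spinSum_mul_left {Λ : Finset V} {R : (V → Bool) → ℝ} (hR : DependsOn R (Λ : Set V)ᶜ)
    (F : (V → Bool) → ℝ) (ω : V → Bool) :
    spinSum Λ (fun η => R η * F η) ω = R ω * spinSum Λ F ω := by
  simp only [spinSum, Finset.mul_sum, hR.glue_eq]

lemma spinSum_const_mul {Λ : Finset V} (c : ℝ)
    (F : (V → Bool) → ℝ) (ω : V → Bool) :
    spinSum Λ (fun η => c * F η) ω = c * spinSum Λ F ω := by
  simp only [spinSum, Finset.mul_sum]

/-- Configurations agreeing with `ω` off `Λ` are the only ones that matter. -/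
lemma spinSum_congr {Λ : Finset V} {F F' : (V → Bool) → ℝ} {ω : V → Bool}
    (h : ∀ η : V → Bool, (∀ v ∉ Λ, η v = ω v) → F η = F' η) :
    spinSum Λ F ω = spinSum Λ F' ω :=
  Finset.sum_congr rfl fun σ _ => h _ fun _ hv => glue_apply_notMem σ ω hv

open scoped Classical in
lemma spinSum_pos {Λ : Finset V} {F : (V → Bool) → ℝ} (h : ∀ η, 0 < F η) (ω : V → Bool) :
    0 < spinSum Λ F ω :=
  Finset.sum_pos (fun _ _ => h _) Finset.univ_nonempty

lemma spinSum_nonneg {Λ : Finset V} {F : (V → Bool) → ℝ} (h : ∀ η, 0 ≤ F η) (ω : V → Bool) :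
    0 ≤ spinSum Λ F ω :=
  Finset.sum_nonneg fun _ _ => h _

lemma spinSum_mono {Λ : Finset V} {F F' : (V → Bool) → ℝ} (h : ∀ η, F η ≤ F' η)
    (ω : V → Bool) : spinSum Λ F ω ≤ spinSum Λ F' ω :=
  Finset.sum_le_sum fun _ _ => h _

lemma dependsOn_spinSum {Λ : Finset V} (F : (V → Bool) → ℝ) :
    DependsOn (spinSum Λ F) (Λ : Set V)ᶜ := by
  intro ω ω' h
  unfold spinSum
  refine Finset.sum_congr rfl fun σ _ => congrArg F ?_
  funext v
  by_cases hv : v ∈ Λ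
  · rw [glue_apply_mem σ ω hv, glue_apply_mem σ ω' hv]
  · rw [glue_apply_notMem σ ω hv, glue_apply_notMem σ ω' hv, h v (by simpa using hv)]

lemma spinSum_prod (Λ : Finset V) (φ : V → Bool → ℝ) (ω : V → Bool) :
    spinSum Λ (fun η => ∏ v ∈ Λ, φ v (η v)) ω = ∏ v ∈ Λ, (φ v true + φ v false) := by
  classical
  have h1 : ∀ σ : Λ → Bool, ∏ v ∈ Λ, φ v (glue Λ σ ω v) = ∏ v : Λ, φ v (σ v) := fun σ => by
    rw [← Finset.prod_coe_sort]
    exact Finset.prod_congr rfl fun v _ => by rw [glue_apply_mem σ ω v.2]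
  have h2 := Finset.sum_prod_piFinset (Finset.univ : Finset Bool) (fun v : Λ => φ v)
  unfold spinSum
  simp only [h1]
  rw [Fintype.piFinset_univ] at h2
  rw [← Finset.prod_coe_sort Λ (fun v => φ v true + φ v false)]
  simpa using h2

lemma continuous_glue {Λ : Finset V} (σ : Λ → Bool) : Continuous (glue Λ σ) := by
  refine continuous_pi fun v => ?_
  by_cases hv : v ∈ Λ
  · simpa only [glue_apply_mem σ _ hv] using continuous_const
  · simpa only [glue_apply_notMem σ _ hv] using continuous_apply v

lemma measurable_glue {Λ : Finset V} (σ : Λ → Bool) : Measurable (glue Λ σ) := by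
  refine measurable_pi_lambda _ fun v => ?_
  by_cases hv : v ∈ Λ
  · simpa only [glue_apply_mem σ _ hv] using measurable_const
  · simpa only [glue_apply_notMem σ _ hv] using measurable_pi_apply v

lemma continuous_spinSum {Λ : Finset V} {F : (V → Bool) → ℝ} (hF : Continuous F) :
    Continuous (spinSum Λ F) :=
  continuous_finsetSum _ fun σ _ => hF.comp (continuous_glue σ)

lemma measurable_spinSum {Λ : Finset V} {F : (V → Bool) → ℝ} (hF : Measurable F) :
    Measurable (spinSum Λ F) :=
  Finset.measurable_sum _ fun σ _ => hF.comp (measurable_glue σ)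

end SpinSums

/-! ### Finite-volume measures and their consistency -/

section Specification

variable {V : Type*} (G : SimpleGraph V) [G.LocallyFinite] (β : ℝ) (J : Sym2 V → ℝ)

lemma edgeSpin_mk (η : V → Bool) (v w : V) : edgeSpin η s(v, w) = spin (η v) * spin (η w) := by
  simp [edgeSpin]

lemma isingWeight_pos (Λ : Finset V) (η : V → Bool) : 0 < isingWeight G β J Λ η :=
  Finset.prod_pos fun _ _ => Real.exp_pos _

lemma continuous_edgeSpin (e : Sym2 V) : Continuous fun η : V → Bool => edgeSpin η e := by
  induction e with | h v w =>
  simp only [edgeSpin_mk]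
  have h (v : V) : Continuous fun η : V → Bool => spin (η v) :=
    (continuous_of_discreteTopology (f := spin)).comp (continuous_apply v)
  exact (h v).mul (h w)

lemma measurable_edgeSpin (e : Sym2 V) : Measurable fun η : V → Bool => edgeSpin η e := by
  induction e with | h v w =>
  simp only [edgeSpin_mk]
  have h (v : V) : Measurable fun η : V → Bool => spin (η v) :=
    (measurable_of_countable spin).comp (measurable_pi_apply v)
  exact (h v).mul (h w)

lemma continuous_isingWeight (Λ : Finset V) : Continuous (isingWeight G β J Λ) :=
  continuous_finsetProd _ fun e _ =>
    Real.continuous_exp.comp (continuous_const.mul (continuous_edgeSpin e))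

lemma measurable_isingWeight (Λ : Finset V) : Measurable (isingWeight G β J Λ) :=
  Finset.measurable_prod _ fun e _ =>
    Real.measurable_exp.comp (measurable_const.mul (measurable_edgeSpin e))

/-- The probability of `A` under the finite-volume measure in `Λ`, as a real number. -/
noncomputable def gibbsProb (Λ : Finset V) (A : Set (V → Bool)) (ω : V → Bool) : ℝ :=
  spinSum Λ (fun η => A.indicator 1 η * isingWeight G β J Λ η) ω /
    spinSum Λ (isingWeight G β J Λ) ω

lemma indicator_one_nonneg (A : Set (V → Bool)) (η : V → Bool) :
    (0 : ℝ) ≤ A.indicator 1 η := Set.indicator_nonneg (fun _ _ => zero_le_one) η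

lemma gibbsProb_nonneg (Λ : Finset V) (A : Set (V → Bool)) (ω : V → Bool) :
    0 ≤ gibbsProb G β J Λ A ω :=
  div_nonneg (spinSum_nonneg (fun η => mul_nonneg (indicator_one_nonneg A η)
    (isingWeight_pos G β J Λ η).le) ω) (spinSum_pos (isingWeight_pos G β J Λ) ω).le

lemma gibbsProb_univ (Λ : Finset V) (ω : V → Bool) : gibbsProb G β J Λ Set.univ ω = 1 := by
  have := (spinSum_pos (Λ := Λ) (isingWeight_pos G β J Λ) ω).ne'
  simp only [gibbsProb, Set.indicator_univ, Pi.one_apply, one_mul]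
  exact div_self this

lemma lintegral_finiteVolumeIsing (Λ : Finset V) (ω : V → Bool) {f : (V → Bool) → ℝ}
    (hf : Measurable f) (h0 : ∀ η, 0 ≤ f η) :
    ∫⁻ η, ENNReal.ofReal (f η) ∂(finiteVolumeIsing G β J Λ ω) =
      ENNReal.ofReal (spinSum Λ (fun η => f η * isingWeight G β J Λ η) ω /
        spinSum Λ (isingWeight G β J Λ) ω) := by
  have hZ := spinSum_pos (Λ := Λ) (isingWeight_pos G β J Λ) ω
  have hZ' : partitionFunction G β J Λ ω = spinSum Λ (isingWeight G β J Λ) ω := rfl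
  unfold finiteVolumeIsing
  rw [lintegral_finsetSum_measure, hZ']
  rw [spinSum.eq_1 Λ (fun η => f η * isingWeight G β J Λ η), Finset.sum_div, ENNReal.ofReal_sum_of_nonneg]
  · refine Finset.sum_congr rfl fun σ _ => ?_
    rw [lintegral_smul_measure, lintegral_dirac' _ hf.ennreal_ofReal, smul_eq_mul,
      ← ENNReal.ofReal_mul (div_nonneg (isingWeight_pos G β J Λ _).le hZ.le)]
    congr 1
    ring
  · exact fun σ _ => div_nonneg (mul_nonneg (h0 _) (isingWeight_pos G β J Λ _).le) hZ.le

lemma measurable_indicator_one {A : Set (V → Bool)} (hA : MeasurableSet A) :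
    Measurable (A.indicator (1 : (V → Bool) → ℝ)) := measurable_one.indicator hA

lemma finiteVolumeIsing_apply (Λ : Finset V) {A : Set (V → Bool)} (hA : MeasurableSet A)
    (ω : V → Bool) :
    finiteVolumeIsing G β J Λ ω A = ENNReal.ofReal (gibbsProb G β J Λ A ω) := by
  rw [gibbsProb, ← lintegral_finiteVolumeIsing G β J Λ ω (measurable_indicator_one hA)
    (indicator_one_nonneg A), ← lintegral_indicator_one hA]
  refine lintegral_congr fun η => ?_
  by_cases h : η ∈ A <;> simp [h]

lemma isProbabilityMeasure_finiteVolumeIsing (Λ : Finset V) (ω : V → Bool) :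
    IsProbabilityMeasure (finiteVolumeIsing G β J Λ ω) :=
  ⟨by rw [finiteVolumeIsing_apply G β J Λ MeasurableSet.univ, gibbsProb_univ, ENNReal.ofReal_one]⟩

lemma measurable_gibbsProb (Λ : Finset V) {A : Set (V → Bool)} (hA : MeasurableSet A) :
    Measurable (gibbsProb G β J Λ A) :=
  (measurable_spinSum ((measurable_indicator_one hA).mul (measurable_isingWeight G β J Λ))).div
    (measurable_spinSum (measurable_isingWeight G β J Λ))

lemma continuous_gibbsProb (Λ : Finset V) {A : Set (V → Bool)} (hA : IsClopen A) :
    Continuous (gibbsProb G β J Λ A) :=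
  (continuous_spinSum ((continuous_one.indicator (by simp [hA.frontier_eq])).mul
    (continuous_isingWeight G β J Λ))).div
    (continuous_spinSum (continuous_isingWeight G β J Λ))
    fun ω => (spinSum_pos (isingWeight_pos G β J Λ) ω).ne'

lemma dependsOn_edgeSpin {Λ : Finset V} {e : Sym2 V} (h : ∀ v ∈ e, v ∉ Λ) :
    DependsOn (fun η : V → Bool => edgeSpin η e) (Λ : Set V)ᶜ := by
  induction e with | h v w =>
  intro η η' hη
  simp only [edgeSpin_mk]
  rw [hη v (by simpa using h v (by simp)), hη w (by simpa using h w (by simp))]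

lemma mem_edgesMeeting {Λ : Finset V} {e : Sym2 V} :
    e ∈ edgesMeeting G Λ ↔ e ∈ G.edgeSet ∧ ∃ v ∈ Λ, v ∈ e := by
  classical
  simp only [edgesMeeting, Finset.mem_biUnion, SimpleGraph.mem_incidenceFinset,
    SimpleGraph.incidenceSet, Set.mem_sep_iff]
  tauto

/-- The weight in a larger set factors into the weight in the smaller one and a part that does
not involve the spins there. -/
lemma exists_isingWeight_eq_mul {Λ M : Finset V} (h : Λ ⊆ M) :
    ∃ R : (V → Bool) → ℝ, DependsOn R (Λ : Set V)ᶜ ∧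
      ∀ η, isingWeight G β J M η = R η * isingWeight G β J Λ η := by
  classical
  refine ⟨fun η => ∏ e ∈ edgesMeeting G M \ edgesMeeting G Λ,
    Real.exp (β * J e * edgeSpin η e), ?_, fun η => ?_⟩
  · intro η η' hη
    refine Finset.prod_congr rfl fun e he => ?_
    rw [Finset.mem_sdiff, mem_edgesMeeting, mem_edgesMeeting] at he
    have := dependsOn_edgeSpin (Λ := Λ) (e := e)
      (fun v hv hvΛ => he.2 ⟨he.1.1, v, hvΛ, hv⟩) hη
    simp only at this
    rw [this]
  · refine (Finset.prod_sdiff ?_).symm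
    intro e
    rw [mem_edgesMeeting, mem_edgesMeeting]
    exact fun ⟨h1, v, hv, hve⟩ => ⟨h1, v, h hv, hve⟩

lemma dependsOn_gibbsProb (Λ : Finset V) (A : Set (V → Bool)) :
    DependsOn (gibbsProb G β J Λ A) (Λ : Set V)ᶜ := by
  intro ω ω' h
  unfold gibbsProb
  rw [dependsOn_spinSum _ h, dependsOn_spinSum _ h]

/-- The finite-volume measures are consistent. -/
lemma lintegral_gibbsProb_finiteVolumeIsing {Λ M : Finset V} (h : Λ ⊆ M) {A : Set (V → Bool)}
    (hA : MeasurableSet A) (ω : V → Bool) :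
    ∫⁻ η, ENNReal.ofReal (gibbsProb G β J Λ A η) ∂(finiteVolumeIsing G β J M ω) =
      finiteVolumeIsing G β J M ω A := by
  rw [lintegral_finiteVolumeIsing G β J M ω (measurable_gibbsProb G β J Λ hA)
    (gibbsProb_nonneg G β J Λ A), finiteVolumeIsing_apply G β J M hA, gibbsProb]
  congr 2
  -- `R` is constant in the inner sum over `Λ`, where the normalization of `gibbsProb` then cancels.
  obtain ⟨R, hR, hW⟩ := exists_isingWeight_eq_mul G β J h
  rw [spinSum_sdiff h, spinSum_sdiff h]
  congr 1
  funext η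
  simp only [hW]
  have e1 : ∀ η, gibbsProb G β J Λ A η * (R η * isingWeight G β J Λ η) =
      (R η * gibbsProb G β J Λ A η) * isingWeight G β J Λ η := fun η => by ring
  have e2 : ∀ η, A.indicator 1 η * (R η * isingWeight G β J Λ η) =
      R η * (A.indicator 1 η * isingWeight G β J Λ η) := fun η => by ring
  have hd : DependsOn (fun η => R η * gibbsProb G β J Λ A η) (Λ : Set V)ᶜ := fun η η' hη => by
    simp only [hR hη, dependsOn_gibbsProb G β J Λ A hη]
  simp only [e1, e2]
  rw [spinSum_mul_left hd, spinSum_mul_left hR, mul_assoc, gibbsProb,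
    div_mul_cancel₀ _ (spinSum_pos (isingWeight_pos G β J Λ) η).ne']

variable {G β J}

lemma IsGibbsState.apply_eq {μ : Measure (V → Bool)} (hμ : IsGibbsState G β J μ) (Λ : Finset V)
    {A : Set (V → Bool)} (hA : MeasurableSet A) :
    μ A = ∫⁻ ω, ENNReal.ofReal (gibbsProb G β J Λ A ω) ∂μ := by
  rw [hμ.dlr Λ A hA]
  exact lintegral_congr fun ω => finiteVolumeIsing_apply G β J Λ hA ω

lemma isClopen_cylinder {s : Finset V} (S : Set (s → Bool)) :
    IsClopen (cylinder (α := fun _ : V => Bool) s S) :=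
  (isClopen_discrete S).preimage (by fun_prop)

lemma measurableSet_cylinder {s : Finset V} (S : Set (s → Bool)) :
    MeasurableSet (cylinder (α := fun _ : V => Bool) s S) :=
  S.toFinite.measurableSet.cylinder s

variable (G β J) in
/-- It suffices to check the DLR equations on cylinders. -/
lemma isGibbsState_of_cylinder {μ : Measure (V → Bool)} [IsProbabilityMeasure μ]
    (h : ∀ (Λ s : Finset V) (S : Set (s → Bool)),
      μ (cylinder (α := fun _ : V => Bool) s S) =
        ∫⁻ ω, finiteVolumeIsing G β J Λ ω (cylinder s S) ∂μ) :
    IsGibbsState G β J μ := by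
  refine ⟨inferInstance, fun Λ A hA => ?_⟩
  have hmeas : Measurable (finiteVolumeIsing G β J Λ) := by
    refine Measure.measurable_of_measurable_coe _ fun A hA => ?_
    simp only [finiteVolumeIsing_apply G β J Λ hA]
    exact (measurable_gibbsProb G β J Λ hA).ennreal_ofReal
  -- The DLR equation says that `μ` is invariant under the kernel, an equality of finite measures
  -- that can be tested on the π-system of cylinders.
  have : μ = μ.bind (finiteVolumeIsing G β J Λ) := by
    refine ext_of_generate_finite (measurableCylinders fun _ : V => Bool)
      generateFrom_measurableCylinders.symm isPiSystem_measurableCylinders ?_ ?_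
    · intro t ht
      obtain ⟨s, S, -, rfl⟩ := (mem_measurableCylinders t).1 ht
      rw [Measure.bind_apply (measurableSet_cylinder S) hmeas.aemeasurable]
      exact h Λ s S
    · rw [Measure.bind_apply MeasurableSet.univ hmeas.aemeasurable]
      simp only [finiteVolumeIsing_apply G β J Λ MeasurableSet.univ, gibbsProb_univ]
      simp
  conv_lhs => rw [this]
  exact Measure.bind_apply hA hmeas.aemeasurable

end Specification

/-! ### Existence by compactness, uniqueness from vanishing boundary influence -/

section ExistenceUniqueness

variable {V : Type*} {G : SimpleGraph V} [G.LocallyFinite] {β : ℝ} {J : Sym2 V → ℝ}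

/-- Weak limit points of finite-volume measures are Gibbs states. -/
theorem exists_isGibbsState_of_exhaustion [Countable V] (B : ℕ → Finset V)
    (hB : ∀ Λ : Finset V, ∀ᶠ N in atTop, Λ ⊆ B N) (ω : V → Bool) :
    ∃ μ : Measure (V → Bool), IsGibbsState G β J μ ∧
      ∀ A : Set (V → Bool), IsClopen A → ∀ c : ℝ,
        (∀ᶠ N in atTop, c ≤ gibbsProb G β J (B N) A ω) → ENNReal.ofReal c ≤ μ A := by
  let μs : ℕ → ProbabilityMeasure (V → Bool) := fun N =>
    ⟨finiteVolumeIsing G β J (B N) ω, isProbabilityMeasure_finiteVolumeIsing G β J (B N) ω⟩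
  -- Compactness gives a limit along an ultrafilter, so no subsequence has to be extracted.
  let U : Ultrafilter ℕ := hyperfilter ℕ
  have hU : (U : Filter ℕ) ≤ atTop := by
    rw [← Nat.cofinite_eq_atTop]; exact hyperfilter_le_cofinite
  obtain ⟨μ, -, hμ⟩ := isCompact_univ.ultrafilter_le_nhds (U.map μs) (by simp)
  have hlim : Tendsto μs U (𝓝 μ) := hμ
  have hclopen : ∀ A : Set (V → Bool), IsClopen A →
      Tendsto (fun N => finiteVolumeIsing G β J (B N) ω A) U (𝓝 ((μ : Measure (V → Bool)) A)) :=
    fun A hA => ProbabilityMeasure.tendsto_measure_of_null_frontier_of_tendsto' hlim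
      (by simp [hA.frontier_eq])
  refine ⟨μ, isGibbsState_of_cylinder G β J fun Λ s S => ?_, fun A hA c hc => ?_⟩
  · have hA := isClopen_cylinder (V := V) S
    set A := cylinder (α := fun _ : V => Bool) s S
    have hAm : MeasurableSet A := measurableSet_cylinder S
    simp only [finiteVolumeIsing_apply G β J Λ hAm]
    let f : BoundedContinuousFunction (V → Bool) ℝ≥0 := BoundedContinuousFunction.mkOfCompact
      ⟨fun η => (gibbsProb G β J Λ A η).toNNReal,
        continuous_real_toNNReal.comp (continuous_gibbsProb G β J Λ hA)⟩
    -- The kernel is continuous on the clopen set `A`, so its integrals converge; once `Λ ⊆ B N`,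
    -- consistency turns them into probabilities of `A`.
    have h1 : Tendsto (fun N => finiteVolumeIsing G β J (B N) ω A) U
        (𝓝 (∫⁻ η, ENNReal.ofReal (gibbsProb G β J Λ A η) ∂(μ : Measure (V → Bool)))) := by
      refine (ProbabilityMeasure.tendsto_iff_forall_lintegral_tendsto.1 hlim f).congr' ?_
      filter_upwards [hU (hB Λ)] with N hN
      exact lintegral_gibbsProb_finiteVolumeIsing G β J hN hAm ω
    exact tendsto_nhds_unique (hclopen A hA) h1
  · refine ge_of_tendsto (hclopen A hA) ?_
    filter_upwards [hU hc] with N hN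
    rw [finiteVolumeIsing_apply G β J (B N) hA.isOpen.measurableSet]
    exact ENNReal.ofReal_le_ofReal hN

/-- If the influence of the boundary condition on every cylinder vanishes, then any two Gibbs
states coincide. -/
theorem IsGibbsState.eq_of_boundary_influence {μ ν : Measure (V → Bool)}
    (hμ : IsGibbsState G β J μ) (hν : IsGibbsState G β J ν)
    (h : ∀ (s : Finset V) (S : Set (s → Bool)) (ε : ℝ), 0 < ε → ∃ Λ : Finset V, ∀ ω ω',
      gibbsProb G β J Λ (cylinder (α := fun _ : V => Bool) s S) ω ≤
        (1 + ε) * gibbsProb G β J Λ (cylinder (α := fun _ : V => Bool) s S) ω') :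
    μ = ν := by
  have key : ∀ {μ ν : Measure (V → Bool)}, IsGibbsState G β J μ → IsGibbsState G β J ν →
      ∀ (s : Finset V) (S : Set (s → Bool)),
        μ (cylinder (α := fun _ : V => Bool) s S) ≤ ν (cylinder s S) := by
    intro μ ν hμ hν s S
    have := hμ.isProbabilityMeasure
    have := hν.isProbabilityMeasure
    have hAm : MeasurableSet (cylinder (α := fun _ : V => Bool) s S) := measurableSet_cylinder S
    have hh := h s S
    set A := cylinder (α := fun _ : V => Bool) s S
    have hε : ∀ ε : ℝ, 0 < ε → μ A ≤ ENNReal.ofReal (1 + ε) * ν A := by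
      intro ε hε
      obtain ⟨Λ, hΛ⟩ := hh ε hε
      -- DLR for `μ` averages over `ω` with `ω'` fixed; DLR for `ν` then averages over `ω'`.
      have h1 : ∀ ω', μ A ≤ ENNReal.ofReal (1 + ε) *
          ENNReal.ofReal (gibbsProb G β J Λ A ω') := by
        intro ω'
        rw [hμ.apply_eq Λ hAm, ← ENNReal.ofReal_mul (by linarith)]
        refine (lintegral_mono fun ω => ENNReal.ofReal_le_ofReal (hΛ ω ω')).trans ?_
        simp
      calc μ A = ∫⁻ _, μ A ∂ν := by simp
        _ ≤ ∫⁻ ω', ENNReal.ofReal (1 + ε) * ENNReal.ofReal (gibbsProb G β J Λ A ω') ∂ν :=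
          lintegral_mono h1
        _ = ENNReal.ofReal (1 + ε) * ν A := by
          rw [lintegral_const_mul _ (measurable_gibbsProb G β J Λ hAm).ennreal_ofReal,
            ← hν.apply_eq Λ hAm]
    have hlim : Tendsto (fun ε : ℝ => ENNReal.ofReal (1 + ε) * ν A) (𝓝[>] 0) (𝓝 (1 * ν A)) := by
      refine ENNReal.Tendsto.mul_const ?_ (Or.inl one_ne_zero)
      have : Tendsto (fun ε : ℝ => ENNReal.ofReal (1 + ε)) (𝓝 0) (𝓝 (ENNReal.ofReal (1 + 0))) :=
        (ENNReal.continuous_ofReal.comp (continuous_const.add continuous_id)).tendsto 0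
      simpa using this.mono_left nhdsWithin_le_nhds
    rw [one_mul] at hlim
    exact ge_of_tendsto hlim (eventually_nhdsWithin_of_forall hε)
  have := hμ.isProbabilityMeasure
  have := hν.isProbabilityMeasure
  refine ext_of_generate_finite (measurableCylinders fun _ : V => Bool)
    generateFrom_measurableCylinders.symm isPiSystem_measurableCylinders ?_ (by simp)
  intro t ht
  obtain ⟨s, S, -, rfl⟩ := (mem_measurableCylinders t).1 ht
  exact le_antisymm (key hμ hν s S) (key hν hμ s S)

end ExistenceUniqueness

/-! ### The one-edge recursion and its nonlinear bounds -/

section Recursion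

open Real

lemma tanh_pos_of_pos {x : ℝ} (hx : 0 < x) : 0 < tanh x := by
  rw [tanh_eq_sinh_div_cosh]; exact div_pos (sinh_pos_iff.2 hx) (cosh_pos x)

lemma tanh_le_self {x : ℝ} (hx : 0 ≤ x) : tanh x ≤ x := by
  have h : MonotoneOn (fun x => x * cosh x - sinh x) (Set.Ici 0) := by
    refine monotoneOn_of_deriv_nonneg (convex_Ici 0) (by fun_prop) (by fun_prop) fun y hy => ?_
    rw [interior_Ici] at hy
    have : HasDerivAt (fun x => x * cosh x - sinh x) (1 * cosh y + y * sinh y - cosh y) y :=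
      ((hasDerivAt_id y).mul (hasDerivAt_cosh y)).sub (hasDerivAt_sinh y)
    rw [this.deriv]
    nlinarith [mul_pos (Set.mem_Ioi.1 hy) (sinh_pos_iff.2 hy)]
  have := h (Set.mem_Ici.2 le_rfl) hx hx
  simp only [zero_mul, sinh_zero, sub_zero] at this
  rw [tanh_eq_sinh_div_cosh, div_le_iff₀ (cosh_pos x)]
  linarith

lemma one_add_sq_div_two_le_cosh (x : ℝ) : 1 + x ^ 2 / 2 ≤ cosh x := by
  have h : cosh x = 1 + 2 * sinh (x / 2) ^ 2 := by
    have := cosh_two_mul (x / 2)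
    rw [mul_div_cancel₀ x two_ne_zero] at this
    rw [this, cosh_sq]; ring
  have h2 : (x / 2) ^ 2 ≤ sinh (x / 2) ^ 2 := by
    rw [sq_le_sq, abs_sinh]
    exact self_le_sinh_iff.2 (abs_nonneg _)
  rw [h]; linarith

lemma add_pow_three_div_six_le_sinh {x : ℝ} (hx : 0 ≤ x) : x + x ^ 3 / 6 ≤ sinh x := by
  have h : Monotone (fun x => sinh x - (x + x ^ 3 / 6)) := by
    refine monotone_of_deriv_nonneg (by fun_prop) fun y => ?_
    have : HasDerivAt (fun x => sinh x - (x + x ^ 3 / 6))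
        (cosh y - (1 + (3 : ℕ) * y ^ (3 - 1) * 1 / 6)) y :=
      (hasDerivAt_sinh y).sub ((hasDerivAt_id y).add (((hasDerivAt_id y).pow 3).div_const 6))
    rw [this.deriv]
    have := one_add_sq_div_two_le_cosh y
    norm_num
    linarith
  have := h hx
  simp only [sinh_zero] at this
  linarith

/-- Half the log-likelihood ratio passed from a vertex to its parent through an edge with
coupling `c`, if the half log-likelihood ratio at the vertex is `h`. -/
noncomputable def passUp (c h : ℝ) : ℝ := log (cosh (h + c) / cosh (h - c)) / 2

@[simp] lemma passUp_zero (c : ℝ) : passUp c 0 = 0 := by simp [passUp, (cosh_pos _).ne']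

lemma passUp_neg (c h : ℝ) : passUp c (-h) = -passUp c h := by
  unfold passUp
  rw [show -h + c = -(h - c) by ring, show -h - c = -(h + c) by ring, cosh_neg, cosh_neg,
    ← inv_div (cosh (h + c)), log_inv]
  ring

lemma exp_passUp (c h : ℝ) : exp (2 * passUp c h) = cosh (h + c) / cosh (h - c) := by
  rw [passUp, mul_div_cancel₀ _ two_ne_zero, exp_log (div_pos (cosh_pos _) (cosh_pos _))]

/-- Summing out a spin at a vertex produces a field at the parent. -/
lemma exists_sum_spin_eq (c h : ℝ) : ∃ a : ℝ, 0 < a ∧ ∀ s : Bool,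
    exp ((c * spin s + h) * spin true) + exp ((c * spin s + h) * spin false) =
      a * exp (passUp c h * spin s) := by
  have h1 := exp_passUp c h
  have h3 := cosh_pos (h + c)
  have h4 := cosh_pos (h - c)
  rw [eq_div_iff h4.ne', two_mul, exp_add] at h1
  refine ⟨2 * cosh (h - c) * exp (passUp c h), by positivity, fun s => ?_⟩
  have h2 : ∀ x, exp (x * spin true) + exp (x * spin false) = 2 * cosh x := fun x => by
    simp [spin, cosh_eq]; ring
  rw [h2]
  cases s
  · have : exp (passUp c h) * exp (passUp c h * spin false) = 1 := by
      rw [← exp_add]; simp [spin]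
    rw [mul_assoc, this]; simp [spin]; ring_nf
  · simp only [spin, if_true, mul_one]
    rw [show c + h = h + c by ring]; linarith

/-- In terms of the mean spin `tanh h`, an edge acts by multiplication by `tanh c`; nonlinearity
enters only when the fields of siblings are added. -/
lemma tanh_passUp (c h : ℝ) : tanh (passUp c h) = tanh c * tanh h := by
  have h1 := exp_passUp c h
  have h4 := cosh_pos (h - c)
  have hp := exp_pos (passUp c h)
  rw [eq_div_iff h4.ne', two_mul, exp_add, cosh_sub, cosh_add] at h1
  rw [tanh_eq, tanh_eq_sinh_div_cosh, tanh_eq_sinh_div_cosh, exp_neg]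
  have hc := cosh_pos c
  have hh := cosh_pos h
  set p := exp (passUp c h)
  have h5 : p - p⁻¹ = (p * p - 1) / p := by field_simp
  have h6 : p + p⁻¹ = (p * p + 1) / p := by field_simp
  rw [h5, h6, div_div_div_cancel_right₀ hp.ne', div_mul_div_comm, div_eq_div_iff (by positivity)
    (by positivity)]
  linear_combination h1

lemma hasDerivAt_passUp (c h : ℝ) :
    HasDerivAt (passUp c) (tanh c / (1 + (1 - tanh c ^ 2) * sinh h ^ 2)) h := by
  have h3 := cosh_pos (h + c)
  have h4 := cosh_pos (h - c)
  have e : passUp c = fun h => (log (cosh (h + c)) - log (cosh (h - c))) / 2 := by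
    funext h
    rw [passUp, log_div (cosh_pos _).ne' (cosh_pos _).ne']
  have d1 : HasDerivAt (fun h => log (cosh (h + c))) (sinh (h + c) / cosh (h + c)) h := by
    simpa using (((hasDerivAt_id h).add_const c).cosh).log h3.ne'
  have d2 : HasDerivAt (fun h => log (cosh (h - c))) (sinh (h - c) / cosh (h - c)) h := by
    simpa using (((hasDerivAt_id h).sub_const c).cosh).log h4.ne'
  rw [e]
  refine ((d1.sub d2).div_const 2).congr_deriv ?_
  have hc := cosh_pos c
  have hs := cosh_sq c
  have hsh := cosh_sq h
  have h5 : cosh (h + c) * cosh (h - c) = cosh c ^ 2 + sinh h ^ 2 := by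
    rw [cosh_add, cosh_sub]; nlinarith
  have h6 : sinh (h + c) * cosh (h - c) - cosh (h + c) * sinh (h - c) =
      2 * (sinh c * cosh c) := by
    rw [cosh_add, cosh_sub, sinh_add, sinh_sub]
    linear_combination 2 * sinh c * cosh c * hsh
  rw [div_sub_div _ _ h3.ne' h4.ne', h5, h6, tanh_eq_sinh_div_cosh]
  have h7 : 1 - (sinh c / cosh c) ^ 2 = 1 / cosh c ^ 2 := by
    field_simp; linarith
  rw [h7]
  have : 0 < cosh c ^ 2 + sinh h ^ 2 := by positivity
  field_simp

lemma strictMono_passUp {c : ℝ} (hc : 0 < c) : StrictMono (passUp c) := by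
  refine strictMono_of_deriv_pos fun h => ?_
  rw [(hasDerivAt_passUp c h).deriv]
  have := tanh_sq_lt_one c
  refine div_pos (tanh_pos_of_pos hc) ?_
  have : 0 ≤ (1 - tanh c ^ 2) * sinh h ^ 2 := mul_nonneg (by linarith) (sq_nonneg _)
  linarith

lemma passUp_pos {c h : ℝ} (hc : 0 < c) (hh : 0 < h) : 0 < passUp c h := by
  simpa using strictMono_passUp hc hh

lemma abs_passUp_le {c h b : ℝ} (hc : 0 < c) (hh : |h| ≤ b) : |passUp c h| ≤ passUp c b := by
  rw [abs_le] at hh ⊢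
  rw [← passUp_neg]
  exact ⟨(strictMono_passUp hc).monotone hh.1, (strictMono_passUp hc).monotone hh.2⟩

/-- Since `tanh g ≤ g`, it is enough to bound the inverse square of `tanh (passUp c h) = tanh c *
tanh h`, and coth² h = 1 + 1/sinh² h ≤ 1 + 1/h². -/
lemma inv_passUp_sq_le {c h : ℝ} (hc : 0 < c) (hh : 0 < h) :
    (passUp c h ^ 2)⁻¹ ≤ (tanh c ^ 2)⁻¹ * ((h ^ 2)⁻¹ + 1) := by
  have hg := passUp_pos hc hh
  have ht := tanh_pos_of_pos hh
  have hs := sinh_pos_iff.2 hh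
  have h1 : (passUp c h ^ 2)⁻¹ ≤ (tanh (passUp c h) ^ 2)⁻¹ := by
    have := tanh_pos_of_pos hg
    exact inv_anti₀ (by positivity) (pow_le_pow_left₀ this.le (tanh_le_self hg.le) 2)
  refine h1.trans ?_
  rw [tanh_passUp, mul_pow, mul_inv]
  refine mul_le_mul_of_nonneg_left ?_ (by positivity)
  have h2 : (tanh h ^ 2)⁻¹ = (sinh h ^ 2)⁻¹ + 1 := by
    rw [tanh_eq_sinh_div_cosh, div_pow, inv_div, cosh_sq]
    field_simp
    ring
  rw [h2]
  have := inv_anti₀ (by positivity) (pow_le_pow_left₀ hh.le (self_le_sinh_iff.2 hh.le) 2)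
  linarith

/-- The majorant is the function whose inverse square is exactly affine in h⁻². Both sides vanish at
0, so derivatives are compared: with ε = 1 - tanh² c and q = 1 + ε h²/2, the claim becomes q³ ≤ (1 +
ε sinh² h)². -/
lemma passUp_le {c h : ℝ} (hc : 0 < c) (hh : 0 ≤ h) :
    passUp c h ≤ tanh c * h / √(1 + (1 - tanh c ^ 2) / 2 * h ^ 2) := by
  set θ := tanh c with hθ
  have hθ0 : 0 < θ := tanh_pos_of_pos hc
  have hε : 0 < 1 - θ ^ 2 := by have := tanh_sq_lt_one c; linarith
  have hε1 : 1 - θ ^ 2 ≤ 1 := by nlinarith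
  set ε := 1 - θ ^ 2 with hεdef
  have hD : ∀ y : ℝ, HasDerivAt (fun y => θ * y / √(1 + ε / 2 * y ^ 2) - passUp c y)
      (θ / ((1 + ε / 2 * y ^ 2) * √(1 + ε / 2 * y ^ 2)) - θ / (1 + ε * sinh y ^ 2)) y := by
    intro y
    have hq : 0 < 1 + ε / 2 * y ^ 2 := by positivity
    refine HasDerivAt.sub ?_ (hasDerivAt_passUp c y)
    have d1 : HasDerivAt (fun y : ℝ => 1 + ε / 2 * y ^ 2) (ε * y) y := by
      have := (((hasDerivAt_id y).pow 2).const_mul (ε / 2)).const_add 1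
      exact this.congr_deriv (by simp; ring)
    have d2 := ((hasDerivAt_id y).const_mul θ).div (d1.sqrt hq.ne') (Real.sqrt_ne_zero'.2 hq)
    refine d2.congr_deriv ?_
    have hs := Real.sq_sqrt hq.le
    have hs0 := Real.sqrt_pos.2 hq
    set S := √(1 + ε / 2 * y ^ 2)
    rw [← hs]
    field_simp
    simp only [id]
    linear_combination (2 : ℝ) * hs
  have hmono : MonotoneOn (fun y => θ * y / √(1 + ε / 2 * y ^ 2) - passUp c y) (Set.Ici 0) := by
    refine monotoneOn_of_deriv_nonneg (convex_Ici 0)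
      (fun y _ => (hD y).continuousAt.continuousWithinAt)
      (fun y _ => (hD y).differentiableAt.differentiableWithinAt) fun y hy => ?_
    rw [interior_Ici] at hy
    have hy0 : 0 < y := hy
    rw [(hD y).deriv, sub_nonneg]
    have hq : 0 < 1 + ε / 2 * y ^ 2 := by positivity
    refine div_le_div_of_nonneg_left hθ0.le (mul_pos hq (Real.sqrt_pos.2 hq)) ?_
    -- The quartic term absorbs the y⁶ term of q³; `y ≤ sinh y` alone would not suffice for large
    -- `y`.
    have hsinh : y ^ 2 + y ^ 4 / 3 ≤ sinh y ^ 2 := by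
      have := pow_le_pow_left₀ (by positivity) (add_pow_three_div_six_le_sinh hy0.le) 2
      nlinarith [pow_pos hy0 6]
    have h1 : 1 + ε * (y ^ 2 + y ^ 4 / 3) ≤ 1 + ε * sinh y ^ 2 := by
      have := mul_le_mul_of_nonneg_left hsinh hε.le
      linarith
    refine le_trans ?_ h1
    refine (pow_le_pow_iff_left₀ (by positivity) (by positivity) two_ne_zero).1 ?_
    rw [mul_pow, Real.sq_sqrt hq.le]
    set x := y ^ 2 with hx
    have hx0 : 0 < x := by positivity
    rw [show y ^ 4 = x ^ 2 by rw [hx]; ring]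
    have e2 : 0 < ε ^ 2 := by positivity
    have e3 : ε ^ 3 ≤ ε ^ 2 := by nlinarith
    have x2 : 0 < x ^ 2 := by positivity
    have x3 : 0 < x ^ 3 := by positivity
    nlinarith [mul_pos hε hx0, mul_pos e2 x2, mul_pos hε x2, mul_pos e2 x3,
      mul_le_mul_of_nonneg_right e3 x3.le, mul_pos e2 (pow_pos hx0 4)]
  have := hmono (Set.mem_Ici.2 le_rfl) hh hh
  simp only [mul_zero, zero_div, passUp_zero, sub_zero] at this
  linarith

lemma le_inv_passUp_sq {c h : ℝ} (hc : 0 < c) (hh : 0 < h) :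
    (tanh c ^ 2)⁻¹ * ((h ^ 2)⁻¹ + (1 - tanh c ^ 2) / 2) ≤ (passUp c h ^ 2)⁻¹ := by
  have hg := passUp_pos hc hh
  have hθ0 := tanh_pos_of_pos hc
  have hε : 0 < 1 - tanh c ^ 2 := by have := tanh_sq_lt_one c; linarith
  have h1 := inv_anti₀ (by positivity) (pow_le_pow_left₀ hg.le (passUp_le hc hh.le) 2)
  refine le_trans (le_of_eq ?_) h1
  rw [div_pow, Real.sq_sqrt (by positivity), inv_div]
  field_simp

end Recursion

/-! ### Parents, levels and balls in a rooted tree -/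

section RootedTrees

variable {V : Type*} {G : SimpleGraph V} {o : V}

/-- Geodesics from the root to the two parents, prolonged to `w`, are paths with the same ends; in a
tree they coincide, and so do their penultimate vertices. -/
lemma IsParent.left_eq (hG : G.IsTree) {v v' w : V} (h : IsParent G o v w)
    (h' : IsParent G o v' w) : v = v' := by
  classical
  obtain ⟨p, hp, hpl⟩ := hG.connected.exists_path_of_dist o v
  obtain ⟨p', hp', hpl'⟩ := hG.connected.exists_path_of_dist o v'
  have key : ∀ {x : V} (q : G.Walk o x), q.length = G.dist o x → IsParent G o x w →
      w ∉ q.support := by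
    intro x q hq hx hw
    have h1 := SimpleGraph.dist_le (q.takeUntil w hw)
    have h2 := q.length_takeUntil_le_length hw
    have := hx.2
    omega
  have e := (hG.isAcyclic.subsingleton_path o w).elim ⟨_, hp.concat (key p hpl h) h.1⟩
    ⟨_, hp'.concat (key p' hpl' h') h'.1⟩
  have e2 := congrArg SimpleGraph.Walk.penultimate (congrArg Subtype.val e)
  simpa using e2

lemma exists_isParent (hG : G.IsTree) {w : V} {n : ℕ} (hw : G.dist o w = n + 1) :
    ∃ v, IsParent G o v w := by
  obtain ⟨p, hp, hpl⟩ := hG.connected.exists_path_of_dist o w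
  have hnil : ¬ p.Nil := by
    intro h
    have := SimpleGraph.Walk.length_eq_zero_iff.2 h
    omega
  have hadj := p.adj_penultimate hnil
  refine ⟨p.penultimate, hadj, ?_⟩
  have h1 := SimpleGraph.dist_le p.dropLast
  have h2 : p.dropLast.length = p.length - 1 := by simp
  rcases hG.dist_eq_dist_add_one_of_adj o hadj with h | h <;> omega

variable [G.LocallyFinite]

open scoped Classical in
variable (G o) in
/-- The children of `v` as a finite set. -/
noncomputable def childFinset (v : V) : Finset V :=
  (G.neighborFinset v).filter fun w => IsParent G o v w

lemma mem_childFinset {v w : V} : w ∈ childFinset G o v ↔ IsParent G o v w := by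
  simp only [childFinset, Finset.mem_filter, SimpleGraph.mem_neighborFinset]
  exact ⟨fun h => h.2, fun h => ⟨h.1, h⟩⟩

lemma card_childFinset (v : V) : (childFinset G o v).card = (children G o v).ncard := by
  rw [← Set.ncard_coe_finset]
  congr 1
  ext w
  simp [mem_childFinset, children]

open scoped Classical in
variable (G o) in
/-- The vertices at distance `n` from the root, generation by generation. -/
noncomputable def levelFinset : ℕ → Finset V
  | 0 => {o}
  | n + 1 => (levelFinset n).biUnion (childFinset G o)

lemma mem_levelFinset (hG : G.IsTree) {n : ℕ} {v : V} :
    v ∈ levelFinset G o n ↔ G.dist o v = n := by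
  induction n generalizing v with
  | zero => simp [levelFinset, hG.connected.dist_eq_zero_iff, eq_comm]
  | succ n ih =>
    simp only [levelFinset, Finset.mem_biUnion, ih, mem_childFinset]
    constructor
    · rintro ⟨u, hu, h⟩
      rw [h.2, hu]
    · intro h
      obtain ⟨u, hu⟩ := exists_isParent hG h
      exact ⟨u, by have := hu.2; omega, hu⟩

lemma pairwiseDisjoint_childFinset (hG : G.IsTree) (s : Set V) :
    s.PairwiseDisjoint (childFinset G o) := by
  intro v _ v' _ hne
  refine Finset.disjoint_left.2 fun w hw hw' => hne ?_
  exact (mem_childFinset.1 hw).left_eq hG (mem_childFinset.1 hw')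

lemma prod_levelFinset_succ {M : Type*} [CommMonoid M] (hG : G.IsTree) (n : ℕ) (f : V → M) :
    ∏ w ∈ levelFinset G o (n + 1), f w =
      ∏ v ∈ levelFinset G o n, ∏ w ∈ childFinset G o v, f w := by
  classical
  exact Finset.prod_biUnion (pairwiseDisjoint_childFinset hG _)

open scoped Classical in
variable (G o) in
/-- The vertices at distance at most `n` from the root. -/
noncomputable def ballFinset (n : ℕ) : Finset V :=
  (Finset.range (n + 1)).biUnion (levelFinset G o)

lemma mem_ballFinset (hG : G.IsTree) {n : ℕ} {v : V} :
    v ∈ ballFinset G o n ↔ G.dist o v ≤ n := by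
  simp [ballFinset, mem_levelFinset hG]

lemma ballFinset_zero : ballFinset G o 0 = {o} := by
  simp [ballFinset, levelFinset]

lemma ballFinset_mono (hG : G.IsTree) {m n : ℕ} (h : m ≤ n) :
    ballFinset G o m ⊆ ballFinset G o n := fun v => by
  rw [mem_ballFinset hG, mem_ballFinset hG]; exact fun h' => h'.trans h

lemma eventually_subset_ballFinset (hG : G.IsTree) (s : Finset V) :
    ∀ᶠ n in atTop, s ⊆ ballFinset G o n := by
  filter_upwards [eventually_ge_atTop (s.sup fun v => G.dist o v)] with n hn v hv
  exact (mem_ballFinset hG).2 ((Finset.le_sup (f := fun v => G.dist o v) hv).trans hn)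

lemma countable_of_isTree (hG : G.IsTree) (o : V) : Countable V := by
  have : (⋃ n, (levelFinset G o n : Set V)) = Set.univ :=
    Set.eq_univ_of_forall fun v => Set.mem_iUnion.2 ⟨G.dist o v, by
      simp [mem_levelFinset hG]⟩
  rw [← Set.countable_univ_iff, ← this]
  exact Set.countable_iUnion fun n => (levelFinset G o n).countable_toSet

/-- After an empty level all levels are empty, and the vertex set would lie in a finite ball. -/
lemma levelFinset_nonempty [Infinite V] (hG : G.IsTree) (n : ℕ) :
    (levelFinset G o n).Nonempty := by
  by_contra h
  rw [Finset.not_nonempty_iff_eq_empty] at h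
  have h2 : ∀ m, n ≤ m → levelFinset G o m = ∅ := fun m hm => by
    induction m, hm using Nat.le_induction with
    | base => exact h
    | succ m _ ih => simp [levelFinset, ih]
  refine Set.infinite_univ (α := V) ((ballFinset G o n).finite_toSet.subset fun v _ => ?_)
  rw [Finset.mem_coe, mem_ballFinset hG]
  by_contra hv
  have := h2 (G.dist o v) (by omega)
  have h3 := (mem_levelFinset (o := o) hG (v := v)).2 rfl
  rw [this] at h3
  simp at h3

lemma pos_of_card_children [Infinite V] (hG : G.IsTree) {d : ℕ → ℕ}
    (hd : ∀ v, (children G o v).ncard = d (G.dist o v)) (n : ℕ) : 0 < d n := by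
  obtain ⟨w, hw⟩ := levelFinset_nonempty (G := G) (o := o) hG (n + 1)
  rw [mem_levelFinset hG] at hw
  obtain ⟨v, hv⟩ := exists_isParent hG hw
  have h1 : G.dist o v = n := by have := hv.2; omega
  rw [← h1, ← hd, ← card_childFinset]
  exact Finset.card_pos.2 ⟨w, mem_childFinset.2 hv⟩

lemma card_levelFinset (hG : G.IsTree) {d : ℕ → ℕ}
    (hd : ∀ v, (children G o v).ncard = d (G.dist o v)) (n : ℕ) :
    (levelFinset G o n).card = ∏ i ∈ Finset.range n, d i := by
  classical
  induction n with
  | zero => simp [levelFinset]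
  | succ n ih =>
    rw [levelFinset, Finset.card_biUnion (fun v _ v' _ h =>
      pairwiseDisjoint_childFinset hG Set.univ trivial trivial h), Finset.prod_range_succ, ← ih,
      ← smul_eq_mul, ← Finset.sum_const]
    refine Finset.sum_congr rfl fun v hv => ?_
    rw [card_childFinset, hd, (mem_levelFinset hG).1 hv]

lemma ncard_level (hG : G.IsTree) (n : ℕ) :
    (level G o n).ncard = (levelFinset G o n).card := by
  rw [← Set.ncard_coe_finset]
  congr 1
  ext v
  simp [level, mem_levelFinset hG]

-- Each edge is oriented away from the root; if it meets the ball, its nearer end lies in the ball.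
open scoped Classical in
lemma edgesMeeting_ballFinset (hG : G.IsTree) (n : ℕ) :
    edgesMeeting G (ballFinset G o n) =
      (ballFinset G o n).biUnion fun v => (childFinset G o v).image fun w => s(v, w) := by
  ext e
  induction e with | h x y =>
  simp only [mem_edgesMeeting, Finset.mem_biUnion, Finset.mem_image, mem_childFinset,
    mem_ballFinset hG, SimpleGraph.mem_edgeSet, Sym2.mem_iff]
  constructor
  · rintro ⟨hxy, v, hv, hve⟩
    rcases hG.dist_eq_dist_add_one_of_adj o hxy with h | h
    · exact ⟨y, by rcases hve with rfl | rfl <;> omega, x, ⟨hxy.symm, h⟩, Sym2.eq_swap⟩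
    · exact ⟨x, by rcases hve with rfl | rfl <;> omega, y, ⟨hxy, h⟩, rfl⟩
  · rintro ⟨v, hv, w, hw, he⟩
    rcases Sym2.eq_iff.1 he with ⟨rfl, rfl⟩ | ⟨rfl, rfl⟩
    · exact ⟨hw.1, v, hv, Or.inl rfl⟩
    · exact ⟨hw.1.symm, v, hv, Or.inr rfl⟩

lemma prod_edgesMeeting_ballFinset {M : Type*} [CommMonoid M] (hG : G.IsTree) (n : ℕ)
    (f : Sym2 V → M) :
    ∏ e ∈ edgesMeeting G (ballFinset G o n), f e =
      ∏ k ∈ Finset.range (n + 1), ∏ v ∈ levelFinset G o k, ∏ w ∈ childFinset G o v,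
        f s(v, w) := by
  classical
  rw [edgesMeeting_ballFinset hG, Finset.prod_biUnion]
  · rw [ballFinset, Finset.prod_biUnion]
    · refine Finset.prod_congr rfl fun k _ => Finset.prod_congr rfl fun v _ => ?_
      refine Finset.prod_image fun w _ w' _ h => ?_
      exact Sym2.congr_right.1 h
    · intro k _ k' _ hne
      refine Finset.disjoint_left.2 fun v hv hv' => hne ?_
      rw [← (mem_levelFinset hG).1 hv, ← (mem_levelFinset hG).1 hv']
  · intro v _ v' _ hne
    refine Finset.disjoint_left.2 fun e he he' => hne ?_
    simp only [Finset.mem_image, mem_childFinset] at he he'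
    obtain ⟨w, hw, rfl⟩ := he
    obtain ⟨w', hw', h⟩ := he'
    have h1 := hw.2
    have h2 := hw'.2
    rcases Sym2.eq_iff.1 h with ⟨rfl, rfl⟩ | ⟨rfl, rfl⟩
    · rfl
    · omega

end RootedTrees

/-! ### Summing out the outer levels: the boundary field -/

section Marginals

variable {V : Type*} {G : SimpleGraph V} [G.LocallyFinite] {o : V} {β : ℝ} {J : Sym2 V → ℝ}

lemma spinSum_empty (F : (V → Bool) → ℝ) (ω : V → Bool) : spinSum ∅ F ω = F ω := by
  classical
  have h : ∀ σ : (∅ : Finset V) → Bool, glue ∅ σ ω = ω := fun σ => by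
    funext v; exact glue_apply_notMem σ ω (by simp)
  simp [spinSum, h]

lemma abs_spin (b : Bool) : |spin b| = 1 := by cases b <;> simp [spin]

lemma dependsOn_compl_iff {α : Type*} {F : (V → Bool) → α} {Λ : Finset V} :
    DependsOn F (Λ : Set V)ᶜ ↔ ∀ η η' : V → Bool, (∀ v ∉ Λ, η v = η' v) → F η = F η' :=
  ⟨fun h η η' hη => h (by simpa using hη), fun h η η' hη => h η η' (by simpa using hη)⟩

variable (G o β J) in
/-- The product of the Boltzmann factors of the edges between levels `n` and `n + 1`. -/
noncomputable def shellWeight (n : ℕ) (η : V → Bool) : ℝ :=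
  ∏ v ∈ levelFinset G o n, ∏ w ∈ childFinset G o v, Real.exp (β * J s(v, w) * edgeSpin η s(v, w))

variable (G o β J) in
/-- The weight of the ball of radius `n` with an external field `h` on level `n`. -/
noncomputable def fieldWeight (n : ℕ) (h : V → ℝ) (η : V → Bool) : ℝ :=
  (∏ k ∈ Finset.range n, shellWeight G o β J k η) *
    ∏ v ∈ levelFinset G o n, Real.exp (h v * spin (η v))

lemma shellWeight_pos (n : ℕ) (η : V → Bool) : 0 < shellWeight G o β J n η :=
  Finset.prod_pos fun _ _ => Finset.prod_pos fun _ _ => Real.exp_pos _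

lemma fieldWeight_pos (n : ℕ) (h : V → ℝ) (η : V → Bool) : 0 < fieldWeight G o β J n h η :=
  mul_pos (Finset.prod_pos fun k _ => shellWeight_pos k η)
    (Finset.prod_pos fun _ _ => Real.exp_pos _)

/-- The last shell, `k = n`, joins the ball to the frozen spins on level `n + 1`. -/
lemma isingWeight_ballFinset (hG : G.IsTree) (n : ℕ) (η : V → Bool) :
    isingWeight G β J (ballFinset G o n) η =
      ∏ k ∈ Finset.range (n + 1), shellWeight G o β J k η :=
  prod_edgesMeeting_ballFinset hG n _

lemma shellWeight_congr (hG : G.IsTree) {n : ℕ} {η η' : V → Bool}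
    (h : ∀ v, G.dist o v ≤ n + 1 → η v = η' v) :
    shellWeight G o β J n η = shellWeight G o β J n η' := by
  refine Finset.prod_congr rfl fun v hv => Finset.prod_congr rfl fun w hw => ?_
  rw [mem_levelFinset hG] at hv
  have hw' := (mem_childFinset.1 hw).2
  rw [edgeSpin_mk, edgeSpin_mk, h v (by omega), h w (by omega)]

lemma fieldWeight_congr (hG : G.IsTree) {n : ℕ} (f : V → ℝ) {η η' : V → Bool}
    (h : ∀ v, G.dist o v ≤ n → η v = η' v) :
    fieldWeight G o β J n f η = fieldWeight G o β J n f η' := by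
  unfold fieldWeight
  congr 1
  · refine Finset.prod_congr rfl fun k hk => shellWeight_congr hG fun v hv => h v ?_
    have := Finset.mem_range.1 hk
    omega
  · refine Finset.prod_congr rfl fun v hv => ?_
    rw [h v ((mem_levelFinset hG).1 hv).le]

/-- Summing out the spins on level `n + 1`. -/
lemma exists_spinSum_fieldWeight_succ (hG : G.IsTree) {c : ℕ → ℝ}
    (hJ : ∀ v w, IsParent G o v w → β * J s(v, w) = c (G.dist o w)) (n : ℕ) (h : V → ℝ) :
    ∃ C : ℝ, 0 < C ∧ ∀ ω, spinSum (levelFinset G o (n + 1)) (fieldWeight G o β J (n + 1) h) ω =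
      C * fieldWeight G o β J n
        (fun v => ∑ w ∈ childFinset G o v, passUp (c (n + 1)) (h w)) ω := by
  classical
  -- Naming the parent as a function of the child makes the weight a product indexed by level `n +
  -- 1`, so the sum splits vertex by vertex.
  have hpar : ∃ par : V → V, ∀ v w, IsParent G o v w → par w = v :=
    ⟨fun w => if hw : ∃ v, IsParent G o v w then hw.choose else w, fun v w hvw => by
      have hw : ∃ v, IsParent G o v w := ⟨v, hvw⟩
      simp only [hw, dif_pos]
      exact hw.choose_spec.left_eq hG hvw⟩
  obtain ⟨par, hpar⟩ := hpar
  choose a ha ha' using fun w => exists_sum_spin_eq (c (n + 1)) (h w)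
  refine ⟨∏ w ∈ levelFinset G o (n + 1), a w, Finset.prod_pos fun w _ => ha w, fun ω => ?_⟩
  have h1 : ∀ η : V → Bool, (∀ v ∉ levelFinset G o (n + 1), η v = ω v) →
      fieldWeight G o β J (n + 1) h η = (∏ k ∈ Finset.range n, shellWeight G o β J k ω) *
        ∏ w ∈ levelFinset G o (n + 1),
          Real.exp ((c (n + 1) * spin (ω (par w)) + h w) * spin (η w)) := by
    intro η hη
    have hη' : ∀ v, G.dist o v ≤ n → η v = ω v := fun v hv => hη v fun hv' => by
      rw [mem_levelFinset hG] at hv'; omega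
    rw [fieldWeight, Finset.prod_range_succ, mul_assoc]
    congr 1
    · refine Finset.prod_congr rfl fun k hk => shellWeight_congr hG fun v hv => hη' v ?_
      have := Finset.mem_range.1 hk
      omega
    · rw [prod_levelFinset_succ hG, prod_levelFinset_succ hG, shellWeight,
        ← Finset.prod_mul_distrib]
      refine Finset.prod_congr rfl fun v hv => ?_
      rw [← Finset.prod_mul_distrib]
      refine Finset.prod_congr rfl fun w hw => ?_
      rw [mem_levelFinset hG] at hv
      rw [mem_childFinset] at hw
      rw [hJ v w hw, hw.2, hv, edgeSpin_mk, hpar v w hw, hη' v hv.le, ← Real.exp_add]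
      ring_nf
  rw [spinSum_congr h1, spinSum_const_mul, spinSum_prod (levelFinset G o (n + 1))
    (fun w b => Real.exp ((c (n + 1) * spin (ω (par w)) + h w) * spin b)) ω]
  simp only [ha']
  rw [Finset.prod_mul_distrib, fieldWeight, mul_left_comm]
  congr 2
  rw [prod_levelFinset_succ hG]
  refine Finset.prod_congr rfl fun v hv => ?_
  rw [Finset.sum_mul, Real.exp_sum]
  refine Finset.prod_congr rfl fun w hw => ?_
  rw [hpar v w (mem_childFinset.1 hw)]

open scoped Classical in
/-- A marginal of a finite-volume measure is described by any weight obtained by summing out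
the other spins. -/
lemma gibbsProb_eq_of_spinSum {Λ M : Finset V} (h : Λ ⊆ M) {A : Set (V → Bool)}
    (hA : ∀ η η' : V → Bool, (∀ v ∈ Λ, η v = η' v) → (η ∈ A ↔ η' ∈ A)) {ω : V → Bool}
    {K : (V → Bool) → ℝ} {C : ℝ} (hC : 0 < C)
    (hK : ∀ η : V → Bool, (∀ v ∉ M, η v = ω v) →
      spinSum (M \ Λ) (isingWeight G β J M) η = C * K η) :
    gibbsProb G β J M A ω = spinSum Λ (fun η => A.indicator 1 η * K η) ω / spinSum Λ K ω := by
  classical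
  have hd : DependsOn (A.indicator (1 : (V → Bool) → ℝ)) (↑(M \ Λ) : Set V)ᶜ :=
    dependsOn_compl_iff.2 fun η η' hη => by
      have := hA η η' fun v hv => hη v (by simp [hv])
      by_cases h1 : η ∈ A
      · simp [h1, this.1 h1]
      · simp [h1, mt this.2 h1]
  have e1 : spinSum M (isingWeight G β J M) ω = C * spinSum Λ K ω := by
    rw [spinSum_sdiff' h, ← spinSum_const_mul]
    refine spinSum_congr fun η hη => ?_
    rw [← hK η fun v hv => hη v fun hv' => hv (h hv')]
  have e2 : spinSum M (fun η => A.indicator 1 η * isingWeight G β J M η) ω =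
      C * spinSum Λ (fun η => A.indicator 1 η * K η) ω := by
    rw [spinSum_sdiff' h, ← spinSum_const_mul]
    refine spinSum_congr fun η hη => ?_
    rw [spinSum_mul_left hd, mul_left_comm, ← hK η fun v hv => hη v fun hv' => hv (h hv')]
  rw [gibbsProb, e1, e2, mul_div_mul_left _ _ hC.ne']

/-- Inverse squares of the growth factors `∏ d_i θ_{i+1}` of the linearized recursion. -/
noncomputable def inverseSquareGrowth (d : ℕ → ℕ) (c : ℕ → ℝ) (n : ℕ) : ℝ :=
  ∏ i ∈ Finset.range n, ((d i * Real.tanh (c (i + 1))) ^ 2)⁻¹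

lemma inverseSquareGrowth_pos {d : ℕ → ℕ} {c : ℕ → ℝ} (hd : ∀ n, 0 < d n)
    (hc : ∀ n, 0 < c (n + 1)) (n : ℕ) : 0 < inverseSquareGrowth d c n :=
  Finset.prod_pos fun i _ => by
    have := tanh_pos_of_pos (hc i)
    have : (0 : ℝ) < d i := by exact_mod_cast hd i
    positivity

lemma sum_Ioc_eq_add {n N : ℕ} (h : n < N) (a : ℕ → ℝ) :
    ∑ k ∈ Finset.Ioc n N, a k = a (n + 1) + ∑ k ∈ Finset.Ioc (n + 1) N, a k := by
  rw [← Finset.sum_insert (by simp)]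
  congr 1
  ext k
  simp only [Finset.mem_insert, Finset.mem_Ioc]
  omega

open scoped Classical in
variable (G o β J) in
/-- Whatever the boundary condition off the ball of radius `N`, the effect on the ball of radius
`n` is that of a field on level `n` bounded by `b`, with equality for constant boundary
conditions. -/
def HasBoundaryField (n N : ℕ) (b : ℝ) : Prop :=
  ∀ ω : V → Bool, ∃ C : ℝ, 0 < C ∧ ∃ h : V → ℝ,
    (∀ v ∈ levelFinset G o n, |h v| ≤ b) ∧
    (∀ s, (∀ v, ω v = s) → ∀ v ∈ levelFinset G o n, h v = spin s * b) ∧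
    ∀ η : V → Bool, (∀ v ∉ ballFinset G o N, η v = ω v) →
      spinSum (ballFinset G o N \ ballFinset G o n)
        (isingWeight G β J (ballFinset G o N)) η = C * fieldWeight G o β J n h η

/-- Nothing is summed out: each frozen child on level `N + 1` contributes a field `± c (N + 1)` to
its parent. -/
lemma hasBoundaryField_self (hG : G.IsTree) {d : ℕ → ℕ}
    (hd : ∀ v, (children G o v).ncard = d (G.dist o v)) {c : ℕ → ℝ} (hc : ∀ n, 0 < c (n + 1))
    (hJ : ∀ v w, IsParent G o v w → β * J s(v, w) = c (G.dist o w)) (N : ℕ) :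
    HasBoundaryField G o β J N N (d N * c (N + 1)) := by
  have hcard : ∀ v ∈ levelFinset G o N, (childFinset G o v).card = d N := fun v hv => by
    rw [card_childFinset, hd, (mem_levelFinset hG).1 hv]
  classical
  intro ω
  refine ⟨1, one_pos, fun v => ∑ w ∈ childFinset G o v, c (N + 1) * spin (ω w), ?_, ?_, ?_⟩
  · intro v hv
    refine (Finset.abs_sum_le_sum_abs _ _).trans (le_of_eq ?_)
    simp [abs_mul, abs_spin, abs_of_pos (hc N), hcard v hv]
  · intro s hs v hv
    simp only [hs, Finset.sum_const, hcard v hv, nsmul_eq_mul]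
    ring
  · intro η hη
    have : ballFinset G o N \ ballFinset G o N = ∅ := by
      ext; simp
    rw [this, spinSum_empty, isingWeight_ballFinset hG, Finset.prod_range_succ, one_mul,
      fieldWeight]
    congr 1
    refine Finset.prod_congr rfl fun v hv => ?_
    rw [Finset.sum_mul, Real.exp_sum]
    refine Finset.prod_congr rfl fun w hw => ?_
    rw [mem_levelFinset hG] at hv
    rw [mem_childFinset] at hw
    have hw' := hw.2
    rw [hJ v w hw, edgeSpin_mk, hw', hv, hη w (by rw [mem_ballFinset hG]; omega)]
    ring_nf

/-- `passUp c` is increasing and odd, so it carries a bound `b` to the bound `passUp c b` and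
constant fields `± b` to constant fields. -/
lemma HasBoundaryField.pred (hG : G.IsTree) {d : ℕ → ℕ}
    (hd : ∀ v, (children G o v).ncard = d (G.dist o v)) {c : ℕ → ℝ} (hc : ∀ n, 0 < c (n + 1))
    (hJ : ∀ v w, IsParent G o v w → β * J s(v, w) = c (G.dist o w)) {n N : ℕ} {b : ℝ}
    (hn : n < N) (hb : HasBoundaryField G o β J (n + 1) N b) :
    HasBoundaryField G o β J n N (d n * passUp (c (n + 1)) b) := by
  classical
  have hcard : ∀ v ∈ levelFinset G o n, (childFinset G o v).card = d n := fun v hv => by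
    rw [card_childFinset, hd, (mem_levelFinset hG).1 hv]
  have hchild : ∀ v ∈ levelFinset G o n, ∀ w ∈ childFinset G o v,
      w ∈ levelFinset G o (n + 1) := fun v hv w hw => by
    rw [mem_levelFinset hG] at hv ⊢
    rw [(mem_childFinset.1 hw).2, hv]
  intro ω
  obtain ⟨C, hC, h, h1, h2, h3⟩ := hb ω
  obtain ⟨C', hC', h4⟩ := exists_spinSum_fieldWeight_succ hG hJ n h
  refine ⟨C * C', mul_pos hC hC',
    fun v => ∑ w ∈ childFinset G o v, passUp (c (n + 1)) (h w), ?_, ?_, fun η hη => ?_⟩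
  rotate_left 2
  · have hu : ballFinset G o N \ ballFinset G o n = levelFinset G o (n + 1) ∪
        ballFinset G o N \ ballFinset G o (n + 1) := by
      ext v
      simp only [Finset.mem_union, Finset.mem_sdiff, mem_ballFinset hG, mem_levelFinset hG]
      omega
    have hdis : Disjoint (levelFinset G o (n + 1))
        (ballFinset G o N \ ballFinset G o (n + 1)) := by
      refine Finset.disjoint_left.2 fun v hv hv' => ?_
      simp only [Finset.mem_sdiff, mem_ballFinset hG] at hv'
      rw [mem_levelFinset hG] at hv
      omega
    rw [hu, spinSum_union hdis, mul_assoc, ← h4, ← spinSum_const_mul]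
    refine spinSum_congr fun ξ hξ => h3 ξ fun v hv => ?_
    rw [← hη v hv]
    refine hξ v fun hv' => hv ?_
    rw [mem_levelFinset hG] at hv'
    rw [mem_ballFinset hG]
    omega
  · intro v hv
    refine (Finset.abs_sum_le_sum_abs _ _).trans ?_
    rw [← hcard v hv, ← nsmul_eq_mul]
    exact Finset.sum_le_card_nsmul _ _ _ fun w hw =>
      abs_passUp_le (hc n) (h1 w (hchild v hv w hw))
  · intro s hs v hv
    have : ∀ w ∈ childFinset G o v, passUp (c (n + 1)) (h w) = spin s * passUp (c (n + 1)) b := by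
      intro w hw
      rw [h2 s hs w (hchild v hv w hw)]
      cases s <;> simp [spin, passUp_neg]
    refine (Finset.sum_congr rfl this).trans ?_
    rw [Finset.sum_const, hcard v hv, nsmul_eq_mul]
    ring

/-- The boundary field, with two-sided bounds. -/
lemma exists_hasBoundaryField [Infinite V] (hG : G.IsTree) {d : ℕ → ℕ}
    (hd : ∀ v, (children G o v).ncard = d (G.dist o v)) {c : ℕ → ℝ} (hc : ∀ n, 0 < c (n + 1))
    (hJ : ∀ v w, IsParent G o v w → β * J s(v, w) = c (G.dist o w)) {κ : ℝ}
    (hκ : ∀ n, κ ≤ (1 - Real.tanh (c (n + 1)) ^ 2) / 2) {n N : ℕ} (hn : n ≤ N) :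
    ∃ b : ℝ, 0 < b ∧ HasBoundaryField G o β J n N b ∧
      κ * ∑ k ∈ Finset.Ioc n N, inverseSquareGrowth d c k ≤
        inverseSquareGrowth d c n * (b ^ 2)⁻¹ ∧
      inverseSquareGrowth d c n * (b ^ 2)⁻¹ ≤
        ∑ k ∈ Finset.Ioc n (N + 1), inverseSquareGrowth d c k := by
  have hdpos := pos_of_card_children hG hd
  have hdpos' : ∀ n, (0 : ℝ) < d n := fun n => by exact_mod_cast hdpos n
  have hApos := inverseSquareGrowth_pos hdpos hc
  have hsucc : ∀ n, inverseSquareGrowth d c (n + 1) = inverseSquareGrowth d c n *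
      (((d n : ℝ) ^ 2)⁻¹ * (Real.tanh (c (n + 1)) ^ 2)⁻¹) := fun n => by
    rw [inverseSquareGrowth, Finset.prod_range_succ, mul_pow, mul_inv]; rfl
  -- Induction runs inwards from the boundary. Passing from level `n + 1` to `n`, the quantity
  -- `inverseSquareGrowth d c n * (b ^ 2)⁻¹` gains between `κ` and 1 times `inverseSquareGrowth d c
  -- (n + 1)`.
  induction hn using Nat.decreasingInduction with
  | self =>
    refine ⟨_, mul_pos (hdpos' N) (hc N), hasBoundaryField_self hG hd hc hJ N, ?_, ?_⟩
    · have := hApos N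
      simp only [Finset.Ioc_self, Finset.sum_empty, mul_zero]
      positivity
    -- The extra index `N + 1` pays for the initial field `d N * c (N + 1)`, compared with `d N *
    -- tanh (c (N + 1))`.
    · rw [sum_Ioc_eq_add (Nat.lt_succ_self N), Finset.Ioc_self, Finset.sum_empty, add_zero, hsucc,
        mul_pow, mul_inv]
      have h1 := tanh_pos_of_pos (hc N)
      have h2 := hApos N
      gcongr
      exact tanh_le_self (hc N).le
  | of_succ n hn ih =>
    obtain ⟨b, hb, hf, h1, h2⟩ := ih
    refine ⟨_, mul_pos (hdpos' n) (passUp_pos (hc n) hb), hf.pred hG hd hc hJ hn, ?_, ?_⟩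
    · rw [sum_Ioc_eq_add hn]
      have h3 := le_inv_passUp_sq (hc n) hb
      have h4 := mul_le_mul_of_nonneg_left h3
        (show 0 ≤ inverseSquareGrowth d c n * ((d n : ℝ) ^ 2)⁻¹ from
          mul_nonneg (hApos n).le (by positivity))
      have h5 := mul_le_mul_of_nonneg_left (hκ n) (hApos (n + 1)).le
      have h6 := hsucc n
      rw [mul_pow, mul_inv]
      have h7 : inverseSquareGrowth d c n * ((d n : ℝ) ^ 2)⁻¹ *
          ((Real.tanh (c (n + 1)) ^ 2)⁻¹ * ((b ^ 2)⁻¹ + (1 - Real.tanh (c (n + 1)) ^ 2) / 2)) =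
          inverseSquareGrowth d c (n + 1) * ((b ^ 2)⁻¹ + (1 - Real.tanh (c (n + 1)) ^ 2) / 2) := by
        rw [h6]; ring
      rw [h7] at h4
      linarith
    · rw [sum_Ioc_eq_add (by omega)]
      have h3 := inv_passUp_sq_le (hc n) hb
      have h4 := mul_le_mul_of_nonneg_left h3
        (show 0 ≤ inverseSquareGrowth d c n * ((d n : ℝ) ^ 2)⁻¹ from
          mul_nonneg (hApos n).le (by positivity))
      have h6 := hsucc n
      rw [mul_pow, mul_inv]
      have h7 : inverseSquareGrowth d c n * ((d n : ℝ) ^ 2)⁻¹ *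
          ((Real.tanh (c (n + 1)) ^ 2)⁻¹ * ((b ^ 2)⁻¹ + 1)) =
          inverseSquareGrowth d c (n + 1) * ((b ^ 2)⁻¹ + 1) := by
        rw [h6]; ring
      rw [h7] at h4
      linarith

end Marginals

/-! ### Multiplicity or uniqueness according to summability -/

section Dichotomy

variable {V : Type*} {G : SimpleGraph V} [G.LocallyFinite] {o : V} {β : ℝ} {J : Sym2 V → ℝ}

lemma not_multipleGibbsStates_of_unique (h : UniqueGibbsState G β J) :
    ¬ MultipleGibbsStates G β J := fun ⟨_, _, hμ, hν, hne⟩ => hne (h.unique hμ hν)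

/-- The reference is the zero field, whose weight does not see the boundary condition. -/
lemma fieldWeight_bounds {n : ℕ} {h : V → ℝ} {b : ℝ}
    (hb : ∀ v ∈ levelFinset G o n, |h v| ≤ b) (η : V → Bool) :
    Real.exp (-((levelFinset G o n).card * b)) * fieldWeight G o β J n 0 η ≤
        fieldWeight G o β J n h η ∧
      fieldWeight G o β J n h η ≤
        Real.exp ((levelFinset G o n).card * b) * fieldWeight G o β J n 0 η := by
  have hT : 0 < ∏ k ∈ Finset.range n, shellWeight G o β J k η :=
    Finset.prod_pos fun k _ => shellWeight_pos k η
  have habs : |∑ v ∈ levelFinset G o n, h v * spin (η v)| ≤ (levelFinset G o n).card * b := by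
    refine (Finset.abs_sum_le_sum_abs _ _).trans ?_
    rw [← nsmul_eq_mul]
    refine Finset.sum_le_card_nsmul _ _ _ fun v hv => ?_
    rw [abs_mul, abs_spin, mul_one]
    exact hb v hv
  have h0 : fieldWeight G o β J n 0 η = ∏ k ∈ Finset.range n, shellWeight G o β J k η := by
    simp [fieldWeight]
  rw [h0, fieldWeight, ← Real.exp_sum]
  rw [abs_le] at habs
  constructor
  · rw [mul_comm]
    exact mul_le_mul_of_nonneg_left (Real.exp_le_exp.2 habs.1) hT.le
  · rw [mul_comm (Real.exp _)]
    exact mul_le_mul_of_nonneg_left (Real.exp_le_exp.2 habs.2) hT.le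

lemma div_bounds_of_bounds {E p p' z z' : ℝ} (hE : 0 < E) (hz : 0 < z) (hz' : 0 < z')
    (hp : 0 ≤ p) (zl : E⁻¹ * z ≤ z') (zu : z' ≤ E * z) (pl : E⁻¹ * p ≤ p') (pu : p' ≤ E * p) :
    E⁻¹ * E⁻¹ * (p / z) ≤ p' / z' ∧ p' / z' ≤ E * E * (p / z) := by
  have hp' : 0 ≤ p' := le_trans (by positivity) pl
  constructor
  · calc E⁻¹ * E⁻¹ * (p / z) = (E⁻¹ * p) / (E * z) := by field_simp
      _ ≤ p' / z' := div_le_div₀ hp' pl hz' zu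
  · calc p' / z' ≤ (E * p) / (E⁻¹ * z) := div_le_div₀ (by positivity) pu (by positivity) zl
      _ = E * E * (p / z) := by field_simp

/-- A small boundary field has little influence on the marginals. -/
lemma HasBoundaryField.gibbsProb_le (hG : G.IsTree) {n N : ℕ} {b : ℝ} (hn : n ≤ N)
    (hb : HasBoundaryField G o β J n N b) {A : Set (V → Bool)}
    (hA : ∀ η η' : V → Bool, (∀ v ∈ ballFinset G o n, η v = η' v) → (η ∈ A ↔ η' ∈ A))
    (ω ω' : V → Bool) :
    gibbsProb G β J (ballFinset G o N) A ω ≤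
      Real.exp (4 * ((levelFinset G o n).card * b)) *
        gibbsProb G β J (ballFinset G o N) A ω' := by
  set x := (levelFinset G o n).card * b with hx
  have hK0 : ∀ η : V → Bool, 0 < fieldWeight G o β J n 0 η := fieldWeight_pos n 0
  have hloc : ∀ η η' : V → Bool, (∀ v ∈ ballFinset G o n, η v = η' v) →
      fieldWeight G o β J n 0 η = fieldWeight G o β J n 0 η' := fun η η' h =>
    fieldWeight_congr hG 0 fun v hv => h v ((mem_ballFinset hG).2 hv)
  have hfree : ∀ F : (V → Bool) → ℝ, (∀ η η' : V → Bool,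
      (∀ v ∈ ballFinset G o n, η v = η' v) → F η = F η') →
      spinSum (ballFinset G o n) F ω = spinSum (ballFinset G o n) F ω' := by
    intro F hF
    refine Finset.sum_congr rfl fun σ _ => hF _ _ fun v hv => ?_
    rw [glue_apply_mem σ ω hv, glue_apply_mem σ ω' hv]
  have hind : ∀ η η' : V → Bool, (∀ v ∈ ballFinset G o n, η v = η' v) →
      A.indicator (1 : (V → Bool) → ℝ) η = A.indicator 1 η' := fun η η' h => by
    have := hA η η' h
    by_cases h1 : η ∈ A
    · simp [h1, this.1 h1]
    · simp [h1, mt this.2 h1]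
  have hZ := hfree _ hloc
  have hP := hfree (fun η => A.indicator 1 η * fieldWeight G o β J n 0 η) fun η η' h => by
    simp only [hind η η' h, hloc η η' h]
  -- Numerator and denominator each move by a factor within `exp (± x)` of the zero field, so the
  -- quotient moves by at most `exp (± 2x)`; comparing two boundary conditions through the zero
  -- field costs `4x`.
  have key : ∀ ω, Real.exp (-(2 * x)) *
      (spinSum (ballFinset G o n) (fun η => A.indicator 1 η * fieldWeight G o β J n 0 η) ω /
        spinSum (ballFinset G o n) (fieldWeight G o β J n 0) ω) ≤
        gibbsProb G β J (ballFinset G o N) A ω ∧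
      gibbsProb G β J (ballFinset G o N) A ω ≤ Real.exp (2 * x) *
      (spinSum (ballFinset G o n) (fun η => A.indicator 1 η * fieldWeight G o β J n 0 η) ω /
        spinSum (ballFinset G o n) (fieldWeight G o β J n 0) ω) := by
    intro ω
    obtain ⟨C, hC, h, h1, -, h3⟩ := hb ω
    rw [gibbsProb_eq_of_spinSum (ballFinset_mono hG hn) hA hC h3]
    have hbd := fieldWeight_bounds (β := β) (J := J) h1
    rw [← hx] at hbd
    have z0 := spinSum_pos (Λ := ballFinset G o n) hK0 ω
    have z1 := spinSum_pos (Λ := ballFinset G o n) (fieldWeight_pos (β := β) (J := J) (o := o)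
      (G := G) n h) ω
    have zl := spinSum_mono (Λ := ballFinset G o n) (fun η => (hbd η).1) ω
    have zu := spinSum_mono (Λ := ballFinset G o n) (fun η => (hbd η).2) ω
    have pl := spinSum_mono (Λ := ballFinset G o n)
      (fun η => mul_le_mul_of_nonneg_left (hbd η).1 (indicator_one_nonneg A η)) ω
    have pu := spinSum_mono (Λ := ballFinset G o n)
      (fun η => mul_le_mul_of_nonneg_left (hbd η).2 (indicator_one_nonneg A η)) ω
    simp only [mul_left_comm (A.indicator _ _), spinSum_const_mul] at zl zu pl pu
    have p0 := spinSum_nonneg (Λ := ballFinset G o n) (fun η =>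
      mul_nonneg (indicator_one_nonneg A η) (hK0 η).le) ω
    have ex := Real.exp_pos x
    have e1 : Real.exp (-x) = (Real.exp x)⁻¹ := Real.exp_neg x
    have e2 : Real.exp (2 * x) = Real.exp x * Real.exp x := by rw [two_mul, Real.exp_add]
    have e3 : Real.exp (-(2 * x)) = (Real.exp x)⁻¹ * (Real.exp x)⁻¹ := by
      rw [Real.exp_neg, e2, mul_inv]
    rw [e1] at zl pl
    rw [e2, e3]
    exact div_bounds_of_bounds ex z0 z1 p0 zl zu pl pu
  have k1 := (key ω).2
  have k2 := (key ω').1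
  rw [hZ, hP] at k1
  refine k1.trans ?_
  have h4 := mul_le_mul_of_nonneg_left k2 (Real.exp_pos (4 * x)).le
  rw [← mul_assoc, ← Real.exp_add, show 4 * x + -(2 * x) = 2 * x by ring] at h4
  exact h4

lemma HasBoundaryField.gibbsProb_root (hG : G.IsTree) {N : ℕ} {b : ℝ}
    (hb : HasBoundaryField G o β J 0 N b) (s : Bool) :
    gibbsProb G β J (ballFinset G o N) {η | η o = s} (fun _ => s) =
      Real.exp b / (Real.exp b + Real.exp (-b)) := by
  obtain ⟨C, hC, h, -, h2, h3⟩ := hb fun _ => s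
  have hA : ∀ η η' : V → Bool, (∀ v ∈ ballFinset G o 0, η v = η' v) →
      (η ∈ {η : V → Bool | η o = s} ↔ η' ∈ {η : V → Bool | η o = s}) := fun η η' h => by
    have := h o (by simp [ballFinset_zero])
    simp [this]
  rw [gibbsProb_eq_of_spinSum (ballFinset_mono hG (Nat.zero_le N)) hA hC h3, ballFinset_zero]
  have ho : h o = spin s * b := h2 s (fun _ => rfl) o (by simp [levelFinset])
  have e1 : fieldWeight G o β J 0 h = fun η => ∏ v ∈ {o}, Real.exp (h v * spin (η v)) := by
    funext η; simp [fieldWeight, levelFinset]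
  have e2 : (fun η : V → Bool => {η : V → Bool | η o = s}.indicator 1 η *
      fieldWeight G o β J 0 h η) =
      fun η => ∏ v ∈ {o}, (if η v = s then 1 else 0) * Real.exp (h v * spin (η v)) := by
    funext η
    rw [e1]
    simp only [Finset.prod_singleton, Set.indicator_apply, Set.mem_ofPred_eq, Pi.one_apply]
  rw [e2, e1, spinSum_prod {o} (fun v t => (if t = s then 1 else 0) * Real.exp (h v * spin t)),
    spinSum_prod {o} (fun v t => Real.exp (h v * spin t))]
  simp only [Finset.prod_singleton, ho]
  cases s <;> simp [spin, add_comm]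

/-- On a spherically symmetric tree with couplings depending on the level, the Gibbs state is
unique if and only if the inverse square growth factors are not summable. -/
theorem multiple_and_unique_of_summable [Infinite V] (hG : G.IsTree) {d : ℕ → ℕ}
    (hd : ∀ v, (children G o v).ncard = d (G.dist o v)) {c : ℕ → ℝ} (hc : ∀ n, 0 < c (n + 1))
    (hJ : ∀ v w, IsParent G o v w → β * J s(v, w) = c (G.dist o w)) {κ : ℝ} (hκ0 : 0 < κ)
    (hκ : ∀ n, κ ≤ (1 - Real.tanh (c (n + 1)) ^ 2) / 2) :
    (Summable (inverseSquareGrowth d c) → MultipleGibbsStates G β J) ∧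
      (¬ Summable (inverseSquareGrowth d c) → UniqueGibbsState G β J) := by
  have hcount : Countable V := countable_of_isTree hG o
  have hApos := inverseSquareGrowth_pos (pos_of_card_children hG hd) hc
  have hlim := exists_isGibbsState_of_exhaustion (G := G) (β := β) (J := J) (ballFinset G o)
    (eventually_subset_ballFinset hG)
  constructor
  · intro hsum
    set S := ∑' k, inverseSquareGrowth d c k
    have hS : 0 < S := hsum.tsum_pos (fun k => (hApos k).le) 0 (hApos 0)
    -- The growth factor at 0 is 1, so `(b ^ 2)⁻¹ ≤ S`: the root field is at least `δ` for every
    -- `N`.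
    set δ := (√S)⁻¹
    have hδ : 0 < δ := inv_pos.2 (Real.sqrt_pos.2 hS)
    have hroot : ∀ s N, (1 + Real.exp (-(2 * δ)))⁻¹ ≤
        gibbsProb G β J (ballFinset G o N) {η | η o = s} (fun _ => s) := by
      intro s N
      obtain ⟨b, hb, hf, -, h2⟩ := exists_hasBoundaryField hG hd hc hJ hκ (Nat.zero_le N)
      have h3 : (b ^ 2)⁻¹ ≤ S := by
        have h4 : inverseSquareGrowth d c 0 = 1 := by simp [inverseSquareGrowth]
        rw [h4, one_mul] at h2
        exact h2.trans (hsum.sum_le_tsum _ fun k _ => (hApos k).le)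
      have h4 : δ ≤ b := by
        refine (pow_le_pow_iff_left₀ hδ.le hb.le two_ne_zero).1 ?_
        rw [inv_pow, Real.sq_sqrt hS.le]
        exact inv_le_of_inv_le₀ (by positivity) h3
      rw [hf.gibbsProb_root hG s]
      have h5 : Real.exp b / (Real.exp b + Real.exp (-b)) = (1 + Real.exp (-(2 * b)))⁻¹ := by
        have : Real.exp (-b) = Real.exp b * Real.exp (-(2 * b)) := by
          rw [← Real.exp_add]; ring_nf
        rw [this]
        have := Real.exp_pos b
        have := Real.exp_pos (-(2 * b))
        field_simp
      rw [h5]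
      gcongr
    obtain ⟨μ, hμ, hμA⟩ := hlim fun _ => true
    obtain ⟨ν, hν, hνA⟩ := hlim fun _ => false
    refine ⟨μ, ν, hμ, hν, fun heq => ?_⟩
    subst heq
    have hclopen : ∀ s, IsClopen {η : V → Bool | η o = s} := fun s =>
      (isClopen_discrete {s}).preimage (continuous_apply o)
    -- If the two limits agreed, two complementary events at the root would both have probability
    -- above 1/2.
    have h1 := hμA _ (hclopen true) _ (Eventually.of_forall (hroot true))
    have h2 := hνA _ (hclopen false) _ (Eventually.of_forall (hroot false))
    have := hμ.isProbabilityMeasure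
    have hun : ({η : V → Bool | η o = true} ∪ {η | η o = false}) = Set.univ := by
      ext η; cases h : η o <;> simp [h]
    have hdis : Disjoint {η : V → Bool | η o = true} {η | η o = false} :=
      Set.disjoint_left.2 fun η h h' => by simp_all
    have h3 := measure_union (μ := μ) hdis (hclopen false).isOpen.measurableSet
    rw [hun, measure_univ] at h3
    have h4 := add_le_add h1 h2
    rw [← h3, ← ENNReal.ofReal_add (by positivity) (by positivity), ENNReal.ofReal_le_one] at h4
    have h5 : Real.exp (-(2 * δ)) < 1 := by
      rw [← Real.exp_zero]; exact Real.exp_lt_exp.2 (by linarith)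
    have h6 : (2 : ℝ)⁻¹ < (1 + Real.exp (-(2 * δ)))⁻¹ := by
      have := Real.exp_pos (-(2 * δ))
      exact inv_strictAnti₀ (by positivity) (by linarith)
    linarith
  · intro hns
    obtain ⟨μ, hμ, -⟩ := hlim fun _ => true
    refine ⟨μ, hμ, fun ν hν => hν.eq_of_boundary_influence hμ fun s S ε hε => ?_⟩
    obtain ⟨n, hn⟩ := (eventually_subset_ballFinset hG (o := o) s).exists
    have hlog : 0 < Real.log (1 + ε) := Real.log_pos (by linarith)
    set m : ℝ := ((levelFinset G o n).card : ℝ)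
    have hm : 0 ≤ m := Nat.cast_nonneg _
    -- Chosen so that `exp (4 * (m * δ)) ≤ 1 + ε`; `m + 1` makes the denominator visibly positive.
    set δ := Real.log (1 + ε) / (4 * (m + 1))
    have hδ : 0 < δ := by positivity
    -- By divergence the sum past `n` can be made large enough to force `b ≤ δ`.
    obtain ⟨N, hnN, hN⟩ : ∃ N, n ≤ N ∧ inverseSquareGrowth d c n * (δ ^ 2)⁻¹ ≤
        κ * ∑ k ∈ Finset.Ioc n N, inverseSquareGrowth d c k := by
      rw [not_summable_iff_tendsto_nat_atTop_of_nonneg fun k => (hApos k).le] at hns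
      obtain ⟨N, hN1, hN2⟩ := ((hns.eventually_ge_atTop (∑ k ∈ Finset.range (n + 1),
        inverseSquareGrowth d c k + inverseSquareGrowth d c n * (δ ^ 2)⁻¹ / κ)).and
        (eventually_ge_atTop (n + 1))).exists
      refine ⟨N - 1, by omega, ?_⟩
      have h1 : ∑ k ∈ Finset.range N, inverseSquareGrowth d c k =
          ∑ k ∈ Finset.range (n + 1), inverseSquareGrowth d c k +
            ∑ k ∈ Finset.Ioc n (N - 1), inverseSquareGrowth d c k := by
        have : Finset.Ioc n (N - 1) = Finset.Ico (n + 1) N := by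
          ext k; simp only [Finset.mem_Ioc, Finset.mem_Ico]; omega
        rw [this, Finset.sum_range_add_sum_Ico _ hN2]
      rw [h1] at hN1
      have h2 := (div_le_iff₀ hκ0).1 (le_of_add_le_add_left hN1)
      linarith
    obtain ⟨b, hb, hf, h1, -⟩ := exists_hasBoundaryField hG hd hc hJ hκ hnN
    have hbδ : b ≤ δ := by
      have h2 := le_of_mul_le_mul_left (hN.trans h1) (hApos n)
      exact (pow_le_pow_iff_left₀ hb.le hδ.le two_ne_zero).1
        ((inv_le_inv₀ (by positivity) (by positivity)).1 h2)
    refine ⟨ballFinset G o N, fun ω ω' => ?_⟩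
    refine (hf.gibbsProb_le hG hnN (fun η η' h => ?_) ω ω').trans ?_
    · rw [mem_cylinder, mem_cylinder]
      have : s.restrict η = s.restrict η' := funext fun v => h v (hn v.2)
      rw [this]
    · refine mul_le_mul_of_nonneg_right ?_ (gibbsProb_nonneg G β J _ _ _)
      rw [← Real.le_log_iff_exp_le (by linarith)]
      have h2 : δ * (4 * (m + 1)) = Real.log (1 + ε) := by
        have : (0 : ℝ) < 4 * (m + 1) := by positivity
        exact div_mul_cancel₀ _ this.ne'
      nlinarith [mul_le_mul_of_nonneg_left hbδ hm]

end Dichotomy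

/-! ### Comparison of series -/

section Summability

lemma tanh_lt_tanh {x y : ℝ} : Real.tanh x < Real.tanh y ↔ x < y := by
  rw [← Real.artanh_lt_artanh_iff ⟨Real.neg_one_lt_tanh x, Real.tanh_lt_one x⟩
    ⟨Real.neg_one_lt_tanh y, Real.tanh_lt_one y⟩, Real.artanh_tanh, Real.artanh_tanh]

lemma tanh_le_tanh {x y : ℝ} : Real.tanh x ≤ Real.tanh y ↔ x ≤ y := by
  rw [← not_lt, tanh_lt_tanh, not_lt]

/-- The theorem pairs `d i` with `θ i`, the recursion pairs it with `θ (i + 1)`; the products differ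
only in the end factors `d 0` and `θ (n + 2)`. -/
lemma inverseSquareGrowth_add_two {d : ℕ → ℕ} {c θ : ℕ → ℝ} (hd : ∀ n, 0 < d n)
    (hθ : ∀ n, θ (n + 1) = Real.tanh (c (n + 1))) (hθ0 : ∀ n, 0 < θ (n + 1)) (n : ℕ) :
    ∏ i ∈ Finset.Icc 1 (n + 1), (((d i : ℝ) * θ i) ^ 2)⁻¹ =
      inverseSquareGrowth d c (n + 2) * ((d 0 : ℝ) * θ (n + 2)) ^ 2 := by
  have hd' : ∀ n, (d n : ℝ) ≠ 0 := fun n => by exact_mod_cast (hd n).ne'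
  have hθ' : ∀ n, θ (n + 1) ≠ 0 := fun n => (hθ0 n).ne'
  simp only [inverseSquareGrowth, ← hθ]
  induction n with
  | zero =>
    have h1 := hθ' 0
    have h2 := hθ' 1
    have h3 := hd' 0
    have h4 := hd' 1
    simp only [zero_add, Nat.reduceAdd] at *
    simp only [Finset.Icc_self, Finset.prod_singleton, Finset.prod_range_succ,
      Finset.range_zero, Finset.prod_empty, zero_add, Nat.reduceAdd]
    field_simp
  | succ n ih =>
    have h1 := hθ' (n + 1)
    have h2 := hθ' (n + 2)
    have h3 := hd' (n + 2)
    rw [Finset.prod_Icc_succ_top (by omega), ih, Finset.prod_range_succ _ (n + 2)]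
    field_simp

/-- The extra factor `(d 0 * θ (n + 2)) ^ 2` lies between positive constants, because `t ≤ θ (n + 2)
< 1`. -/
lemma summable_inverseSquareGrowth_iff {d : ℕ → ℕ} {c θ : ℕ → ℝ} (hd : ∀ n, 0 < d n)
    (hθ : ∀ n, θ (n + 1) = Real.tanh (c (n + 1))) {t : ℝ} (ht : 0 < t)
    (hθt : ∀ n, t ≤ θ (n + 1)) :
    Summable (inverseSquareGrowth d c) ↔
      Summable fun n : ℕ => ∏ i ∈ Finset.Icc 1 (n + 1), (((d i : ℝ) * θ i) ^ 2)⁻¹ := by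
  have hθ0 : ∀ n, 0 < θ (n + 1) := fun n => ht.trans_le (hθt n)
  have hd0 : (0 : ℝ) < d 0 := by exact_mod_cast hd 0
  have hA : ∀ n, 0 ≤ inverseSquareGrowth d c n := fun n =>
    Finset.prod_nonneg fun _ _ => by positivity
  rw [← summable_nat_add_iff 2]
  simp only [inverseSquareGrowth_add_two hd hθ hθ0]
  constructor
  · intro h
    refine Summable.of_nonneg_of_le (fun n => mul_nonneg (hA _) (sq_nonneg _)) (fun n => ?_)
      (h.mul_right ((d 0 : ℝ) ^ 2))
    refine mul_le_mul_of_nonneg_left (pow_le_pow_left₀ (mul_pos hd0 (hθ0 _)).le ?_ 2) (hA _)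
    have : θ (n + 2) < 1 := by rw [hθ (n + 1)]; exact Real.tanh_lt_one _
    nlinarith
  · intro h
    refine Summable.of_nonneg_of_le (fun n => hA _) (fun n => ?_)
      (h.mul_right (((d 0 : ℝ) * t) ^ 2)⁻¹)
    have h1 : ((d 0 : ℝ) * t) ^ 2 ≤ ((d 0 : ℝ) * θ (n + 2)) ^ 2 :=
      pow_le_pow_left₀ (by positivity) (mul_le_mul_of_nonneg_left (hθt (n + 1)) hd0.le) 2
    rw [← div_eq_mul_inv, le_div_iff₀ (by positivity)]
    exact mul_le_mul_of_nonneg_left h1 (hA _)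

lemma summable_pow_mul_rpow_of_lt_one {r : ℝ} (h0 : 0 < r) (h1 : r < 1) (p : ℝ) :
    Summable fun n : ℕ => r ^ n * (n : ℝ) ^ p := by
  have h := summable_pow_mul_geometric_of_norm_lt_one ⌈p⌉₊
    (show ‖r‖ < 1 by rwa [Real.norm_of_nonneg h0.le])
  refine Summable.of_norm_bounded_eventually_nat h ?_
  filter_upwards [eventually_ge_atTop 1] with n hn
  have hn' : (1 : ℝ) ≤ n := by exact_mod_cast hn
  rw [Real.norm_of_nonneg (by positivity), mul_comm]
  refine mul_le_mul_of_nonneg_right ?_ (by positivity)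
  rw [← Real.rpow_natCast]
  exact Real.rpow_le_rpow_of_exponent_le hn' (Nat.le_ceil p)

/-- The reciprocal terms are summable and tend to 0; if these terms did too, their product could not
be 1. -/
lemma not_summable_pow_mul_rpow_of_one_lt {r : ℝ} (h1 : 1 < r) (p : ℝ) :
    ¬ Summable fun n : ℕ => r ^ n * (n : ℝ) ^ p := by
  intro h
  have h0 : 0 < r := one_pos.trans h1
  have h2 := summable_pow_mul_rpow_of_lt_one (inv_pos.2 h0) (inv_lt_one_of_one_lt₀ h1) (-p)
  have h3 := h.tendsto_atTop_zero.mul h2.tendsto_atTop_zero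
  rw [mul_zero] at h3
  have h4 : (fun _ : ℕ => (1 : ℝ)) =ᶠ[atTop] fun n : ℕ =>
      r ^ n * (n : ℝ) ^ p * (r⁻¹ ^ n * (n : ℝ) ^ (-p)) := by
    filter_upwards [eventually_ge_atTop 1] with n hn
    have hn' : (0 : ℝ) < n := by exact_mod_cast hn
    have := Real.rpow_pos_of_pos hn' p
    rw [Real.rpow_neg hn'.le, inv_pow]
    field_simp
  exact one_ne_zero (tendsto_nhds_unique tendsto_const_nhds (h3.congr' h4.symm))

/-- The terms are comparable to (θ/t)^{2n} n^{-2α}. The geometric factor decides unless `θ = t`,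
when a p-series with exponent 2α remains. -/
lemma summable_of_isTheta_growth {T : ℕ → ℝ} {θ α t : ℝ} (hθ : 0 < θ) (ht : 0 < t)
    (hT : T =Θ[atTop] fun n : ℕ => (θ ^ n)⁻¹ * (n : ℝ) ^ α) :
    (Summable fun n : ℕ => ((T n * t ^ n) ^ 2)⁻¹) ↔ θ < t ∨ θ = t ∧ 1 / 2 < α := by
  have h1 : (fun n : ℕ => ((T n * t ^ n) ^ 2)⁻¹) =Θ[atTop]
      fun n : ℕ => (((θ ^ n)⁻¹ * (n : ℝ) ^ α * t ^ n) ^ 2)⁻¹ :=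
    ((hT.mul (isTheta_refl (fun n : ℕ => t ^ n) atTop)).pow 2).inv
  have h2 : (fun n : ℕ => (((θ ^ n)⁻¹ * (n : ℝ) ^ α * t ^ n) ^ 2)⁻¹) =
      fun n : ℕ => ((θ / t) ^ 2) ^ n * (n : ℝ) ^ (-(2 * α)) := by
    funext n
    have hn : (0 : ℝ) ≤ n := n.cast_nonneg
    rw [Real.rpow_neg hn, mul_comm 2 α, Real.rpow_mul hn, Real.rpow_two]
    simp only [mul_pow, mul_inv, inv_pow, inv_inv, div_pow]
    rw [← pow_mul, ← pow_mul, ← pow_mul, ← pow_mul]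
    ring_nf
  rw [h2] at h1
  have h3 : (Summable fun n : ℕ => ((T n * t ^ n) ^ 2)⁻¹) ↔
      Summable fun n : ℕ => ((θ / t) ^ 2) ^ n * (n : ℝ) ^ (-(2 * α)) :=
    ⟨fun h => summable_of_isBigO_nat h h1.2, fun h => summable_of_isBigO_nat h h1.1⟩
  rw [h3]
  have hpos : 0 < θ / t := div_pos hθ ht
  rcases lt_trichotomy θ t with h | h | h
  · have h4 : θ / t < 1 := (div_lt_one ht).2 h
    simp only [h, true_or, iff_true]
    exact summable_pow_mul_rpow_of_lt_one (by positivity) (by nlinarith) _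
  · have h4 : θ / t = 1 := by rw [h, div_self ht.ne']
    rw [h4]
    simp only [one_pow, one_mul, h, lt_irrefl, false_or, true_and]
    rw [Real.summable_nat_rpow]
    constructor <;> intro h5 <;> linarith
  · have h4 : 1 < θ / t := (one_lt_div ht).2 h
    simp only [h.not_gt, h.ne', false_and, or_self, iff_false]
    exact not_summable_pow_mul_rpow_of_one_lt (by nlinarith) _

end Summability

/-! ### Constant coupling and the critical temperature -/

section CriticalTemperature

variable {V : Type*} [Infinite V] {G : SimpleGraph V} [G.LocallyFinite] {o : V}

/-- For constant interactions, the Gibbs state is unique exactly when the tree grows slowly. -/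
lemma multiple_and_unique_of_isTheta (hG : G.IsTree) {d : ℕ → ℕ}
    (hd : ∀ v, (children G o v).ncard = d (G.dist o v)) {J θ α : ℝ} (hJ : 0 < J) (hθ : 0 < θ)
    (hT : (fun n : ℕ => ((level G o n).ncard : ℝ)) =Θ[atTop]
        fun n : ℕ => (θ ^ n)⁻¹ * (n : ℝ) ^ α) {β : ℝ} (hβ : 0 < β) :
    ((θ < Real.tanh (β * J) ∨ θ = Real.tanh (β * J) ∧ 1 / 2 < α) →
        MultipleGibbsStates G β fun _ => J) ∧
      (¬ (θ < Real.tanh (β * J) ∨ θ = Real.tanh (β * J) ∧ 1 / 2 < α) →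
        UniqueGibbsState G β fun _ => J) := by
  have hpos : 0 < β * J := mul_pos hβ hJ
  -- For a constant coupling the product of the `d i` is the size of the level.
  have hA : inverseSquareGrowth d (fun _ => β * J) =
      fun n => (((level G o n).ncard * Real.tanh (β * J) ^ n) ^ 2)⁻¹ := by
    funext n
    rw [ncard_level hG, card_levelFinset hG hd, inverseSquareGrowth]
    simp [Finset.prod_inv_distrib, Finset.prod_pow, Finset.prod_mul_distrib]
  have hκ : 0 < (1 - Real.tanh (β * J) ^ 2) / 2 := by
    have := Real.tanh_sq_lt_one (β * J)
    linarith
  have := multiple_and_unique_of_summable (β := β) (J := fun _ => J) hG hd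
    (c := fun _ => β * J) (fun _ => hpos) (fun _ _ _ => rfl) hκ (fun _ => le_rfl)
  rwa [hA, summable_of_isTheta_growth hθ (tanh_pos_of_pos hpos) hT] at this

end CriticalTemperature

theorem corollary2p3 {V : Type*} [Infinite V] (G : SimpleGraph V) [G.LocallyFinite]
    (hG : G.IsTree) (o : V) (d : ℕ → ℕ)
    (hd : ∀ v, (children G o v).ncard = d (G.dist o v)) :
    (∀ (β Jmin Jmax : ℝ) (J : Sym2 V → ℝ) (θ : ℕ → ℝ),
      0 < β → 0 < Jmin → (∀ e ∈ G.edgeSet, Jmin ≤ J e ∧ J e ≤ Jmax) →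
      (∀ v w, IsParent G o v w → Real.tanh (β * J s(v, w)) = θ (G.dist o w)) →
      (MultipleGibbsStates G β J ↔
        Summable fun n : ℕ => ∏ i ∈ Finset.Icc 1 (n + 1), (((d i : ℝ) * θ i) ^ 2)⁻¹)) ∧
    (∀ (J θ α : ℝ), 0 < J → 0 < θ → θ < 1 →
      ((fun n : ℕ => ((level G o n).ncard : ℝ)) =Θ[atTop]
        fun n : ℕ => (θ ^ n)⁻¹ * (n : ℝ) ^ α) →
      ∀ β : ℝ,
        (IsCritical G β (fun _ => J) ↔ Real.tanh (β * J) = θ) ∧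
        (IsCritical G β (fun _ => J) →
          (UniqueGibbsState G β (fun _ => J) ↔ α ≤ 1 / 2))) := by
  constructor
  · intro β Jmin Jmax J θ hβ hJmin hJ hθ
    -- Injectivity of `tanh` makes the couplings functions of the level. The value at 0 plays no
    -- role, as `θ 0` is unconstrained.
    set c : ℕ → ℝ := fun n => Real.artanh (θ n) with hcdef
    have hJc : ∀ v w, IsParent G o v w → β * J s(v, w) = c (G.dist o w) := fun v w h => by
      rw [hcdef, ← Real.artanh_tanh (β * J s(v, w)), hθ v w h]
    have hlevel : ∀ n, ∃ v w, IsParent G o v w ∧ G.dist o w = n + 1 := fun n => by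
      obtain ⟨w, hw⟩ := levelFinset_nonempty (o := o) hG (n + 1)
      rw [mem_levelFinset hG] at hw
      obtain ⟨v, hv⟩ := exists_isParent hG hw
      exact ⟨v, w, hv, hw⟩
    have hbound : ∀ n, β * Jmin ≤ c (n + 1) ∧ c (n + 1) ≤ β * Jmax ∧
        θ (n + 1) = Real.tanh (c (n + 1)) := fun n => by
      obtain ⟨v, w, hvw, hw⟩ := hlevel n
      have h1 := hJ s(v, w) hvw.1
      have h2 := hJc v w hvw
      have h3 := hθ v w hvw
      rw [hw] at h2 h3
      rw [← h2, ← h3]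
      exact ⟨mul_le_mul_of_nonneg_left h1.1 hβ.le, mul_le_mul_of_nonneg_left h1.2 hβ.le, rfl⟩
    have hmin : 0 < β * Jmin := mul_pos hβ hJmin
    have hc : ∀ n, 0 < c (n + 1) := fun n => hmin.trans_le (hbound n).1
    -- The upper bound `Jmax` keeps the biases away from 1, so the nonlinear gain is uniform in the
    -- level.
    have hκ0 : 0 < (1 - Real.tanh (β * Jmax) ^ 2) / 2 := by
      have := Real.tanh_sq_lt_one (β * Jmax)
      linarith
    have hκ : ∀ n, (1 - Real.tanh (β * Jmax) ^ 2) / 2 ≤ (1 - Real.tanh (c (n + 1)) ^ 2) / 2 :=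
      fun n => by
        have := pow_le_pow_left₀ (tanh_pos_of_pos (hc n)).le (tanh_le_tanh.2 (hbound n).2.1) 2
        linarith
    obtain ⟨h1, h2⟩ := multiple_and_unique_of_summable (β := β) (J := J) hG hd hc hJc hκ0 hκ
    rw [← summable_inverseSquareGrowth_iff (c := c) (pos_of_card_children hG hd)
      (fun n => (hbound n).2.2) (tanh_pos_of_pos hmin)
      fun n => (hbound n).2.2 ▸ tanh_le_tanh.2 (hbound n).1]
    exact ⟨fun h => by_contra fun hs => not_multipleGibbsStates_of_unique (h2 hs) h, h1⟩
  · intro J θ α hJ hθ hθ1 hT β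
    have hmain := fun β' (hβ' : 0 < β') => multiple_and_unique_of_isTheta hG hd hJ hθ hT hβ'
    have hcrit : IsCritical G β (fun _ => J) ↔ Real.tanh (β * J) = θ := by
      constructor
      · rintro ⟨hβ, hlow, hhigh⟩
        set βc := Real.artanh θ / J with hβc
        have hβc0 : 0 < βc := div_pos (Real.artanh_pos ⟨hθ, hθ1⟩) hJ
        have hβcθ : Real.tanh (βc * J) = θ := by
          rw [hβc, div_mul_cancel₀ _ hJ.ne', Real.tanh_artanh ⟨by linarith, hθ1⟩]
        -- An inverse temperature strictly between `β` and `βc` would have both a unique and several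
        -- Gibbs states.
        rcases lt_trichotomy β βc with h | h | h
        · exfalso
          obtain ⟨b, hb1, hb2⟩ := exists_between h
          refine not_multipleGibbsStates_of_unique ((hmain b (hβ.trans hb1)).2 ?_) (hhigh b hb1)
          have : Real.tanh (b * J) < θ := by
            rw [← hβcθ, tanh_lt_tanh]; exact mul_lt_mul_of_pos_right hb2 hJ
          rintro (h' | ⟨h', -⟩) <;> linarith
        · rw [h, hβcθ]
        · exfalso
          obtain ⟨b, hb1, hb2⟩ := exists_between h
          refine not_multipleGibbsStates_of_unique (hlow b (hβc0.trans hb1) hb2)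
            ((hmain b (hβc0.trans hb1)).1 (Or.inl ?_))
          rw [← hβcθ, tanh_lt_tanh]
          exact mul_lt_mul_of_pos_right hb1 hJ
      · intro h
        have hβ : 0 < β := by
          rw [← h, ← Real.tanh_zero, tanh_lt_tanh] at hθ
          exact pos_of_mul_pos_left hθ hJ.le
        refine ⟨hβ, fun b hb hbβ => (hmain b hb).2 ?_, fun b hbβ =>
          (hmain b (hβ.trans hbβ)).1 (Or.inl ?_)⟩
        · have : Real.tanh (b * J) < θ := by
            rw [← h, tanh_lt_tanh]; exact mul_lt_mul_of_pos_right hbβ hJ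
          rintro (h' | ⟨h', -⟩) <;> linarith
        · rw [← h, tanh_lt_tanh]
          exact mul_lt_mul_of_pos_right hbβ hJ
    refine ⟨hcrit, fun hc => ?_⟩
    have hβ := hc.1
    rw [hcrit] at hc
    obtain ⟨h1, h2⟩ := hmain β hβ
    simp only [hc, lt_irrefl, false_or, true_and, not_lt] at h1 h2
    exact ⟨fun hu => not_lt.1 fun hα => not_multipleGibbsStates_of_unique hu (h1 hα), h2⟩
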